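/- Throughout, $\hat\otimes$ is the minimal (spatial) tensor product. A unital $\sigma$-$C^*$-algebra is a unital topological $*$-algebra isomorphic to the inverse limit $\varprojlim_n A_n$, taken in topological $*$-algebras, of a sequence of $C^*$-algebras. A $\sigma$-$C^*$-quantum group is a unital $\sigma$-$C^*$-algebra $A$ with a unital (automatically continuous) $*$-homomorphism $\Delta:A\to A\hat\otimes A$ such that $(\Delta\hat\otimes\mathrm{id})\Delta=(\mathrm{id}\hat\otimes\Delta)\Delta$ and such that the linear spans of $\Delta(A)(A\hat\otimes 1)$ and $\Delta(A)(1\hat\otimes A)$ are dense in $A\hat\otimes A$. A $C^*$-compact quantum group is a unital $C^*$-algebra with a $\Delta$ satisfying these conditions. (1) Every $C^*$-compact quantum group is a $\sigma$-$C^*$-quantum group. (2) Let $\{(A_n,\Delta_n),\theta_n:A_n\to A_{n-1}\}$ be a sequence of $C^*$-compact quantum groups and surjective unital $*$-homomorphisms with $(\theta_n\hat\otimes\theta_n)\Delta_n=\Delta_{n-1}\theta_n$ for all $n$, and let $A=\varprojlim_n A_n$ with projections $p_n:A\to A_n$. Then the maps $p_n\hat\otimes p_n$ identify $A\hat\otimes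 A$ with $\varprojlim_n A_n\hat\otimes A_n$, there is a unique unital $*$-homomorphism $\Delta=\varprojlim_n\Delta_n:A\to A\hat\otimes A$ with $(p_n\hat\otimes p_n)\Delta=\Delta_np_n$ for all $n$, and $(A,\Delta)$ is a $\sigma$-$C^*$-quantum group. (3) Let $q\in(0,1)$, and let $C(SU_q(n))$ be the universal unital $C^*$-algebra generated by $u^n_{ij}$, $1\le i,j\le n$, with the relations $$\sum_k u^n_{ik}(u^n_{jk})^*=\delta_{ij}1,\qquad \sum_k (u^n_{ki})^*u^n_{kj}=\delta_{ij}1,\qquad \sum_{i_1,\dots,i_n}E_{i_1\cdots i_n}u^n_{j_1i_1}\cdots u^n_{j_ni_n}=E_{j_1\cdots j_n}1,$$ where $E_{i_1\cdots i_n}=0$ if $i_1,\dots,i_n$ are not distinct and $E_{i_1\cdots i_n}=(-q)^{\ell}$ otherwise, $\ell$ being the number of pairs $a<b$ with $i_a>i_b$. This $C^*$-algebra exists. For $n\ge2$ it is a $C^*$-compact quantum group with $\Delta_n(u^n_{ij})=\sum_k u^n_{ik}\otimes u^n_{kj}$. For $n\ge3$ there is a surjective unital $*$-homomorphism $\theta_n:C(SU_q(n))\to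 C(SU_q(n-1))$ with $\theta_n(u^n_{ij})=u^{n-1}_{ij}$ if $i,j\le n-1$ and $\theta_n(u^n_{ij})=\delta_{ij}1$ otherwise, and $(\theta_n\hat\otimes\theta_n)\Delta_n=\Delta_{n-1}\theta_n$. Consequently $C(SU_q(\infty))=\varprojlim_{n\ge2}C(SU_q(n))$ with $\Delta=\varprojlim_n\Delta_n$ is a $\sigma$-$C^*$-quantum group. -/

import Mathlib

open scoped TensorProduct

namespace SigmaCStar

open UniformSpace (Completion)
open UniformSpace.Completion

universe u v w

noncomputable section

/-! ### Completions of topological star algebras -/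

section StarCompletion

variable {F : Type u} [Ring F] [UniformSpace F] [IsUniformAddGroup F] [StarRing F]
  [ContinuousStar F]

theorem uniformContinuous_star : UniformContinuous (star : F → F) :=
  uniformContinuous_addMonoidHom_of_continuous (f := (starAddEquiv : F ≃+ F).toAddMonoidHom)
    continuous_star

instance completionStar : Star (Completion F) := ⟨Completion.map star⟩

theorem coe_star (a : F) : ((star a : F) : Completion F) = star (a : Completion F) :=
  (Completion.map_coe uniformContinuous_star a).symm

instance completionContinuousStar : ContinuousStar (Completion F) := ⟨Completion.continuous_map⟩

variable [IsTopologicalRing F]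

instance completionStarRing : StarRing (Completion F) where
  star_involutive x := Completion.induction_on x
    (isClosed_eq (continuous_star.comp continuous_star) continuous_id)
    fun a => by rw [← coe_star, ← coe_star, star_star]
  star_mul x y := Completion.induction_on₂ x y
    (isClosed_eq (by fun_prop) (by fun_prop))
    fun a b => by rw [← coe_mul, ← coe_star, star_mul, coe_mul, coe_star, coe_star]
  star_add x y := Completion.induction_on₂ x y
    (isClosed_eq (by fun_prop) (by fun_prop))
    fun a b => by rw [← coe_add, ← coe_star, star_add, coe_add, coe_star, coe_star]

variable [Algebra ℂ F] [StarModule ℂ F] [UniformContinuousConstSMul ℂ F]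

instance completionStarModule : StarModule ℂ (Completion F) where
  star_smul c x := Completion.induction_on x
    (isClosed_eq (continuous_star.comp (continuous_const_smul c))
      (continuous_star.const_smul (star c)))
    fun a => by rw [← coe_smul, ← coe_star, star_smul, coe_smul, coe_star]

end StarCompletion

/-! ### The completion of a star algebra with respect to a family of representations -/

section Reps

variable {F : Type u} [Ring F] [StarRing F] [Algebra ℂ F] [StarModule ℂ F]
  {ι : Type v} {H : ι → Type w} [∀ i, NormedAddCommGroup (H i)]
  [∀ i, InnerProductSpace ℂ (H i)] [∀ i, CompleteSpace (H i)]

/-- The star algebra `F`, to be equipped with the coarsest topology that makes all the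
`*`-representations `f i` on Hilbert spaces norm continuous. -/
@[nolint unusedArguments]
def WithReps (_f : ∀ i, F →⋆ₐ[ℂ] (H i →L[ℂ] H i)) : Type u := F

variable (f : ∀ i, F →⋆ₐ[ℂ] (H i →L[ℂ] H i))

instance : Ring (WithReps f) := inferInstanceAs (Ring F)
instance : StarRing (WithReps f) := inferInstanceAs (StarRing F)
instance : Algebra ℂ (WithReps f) := inferInstanceAs (Algebra ℂ F)
instance : StarModule ℂ (WithReps f) := inferInstanceAs (StarModule ℂ F)

/-- The identity map `F → WithReps f`. -/
def toReps : F →⋆ₐ[ℂ] WithReps f := StarAlgHom.id ℂ F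

/-- The representation `f i`, seen on `WithReps f`. -/
def evalRep (i : ι) : WithReps f →⋆ₐ[ℂ] (H i →L[ℂ] H i) := f i

instance : UniformSpace (WithReps f) := ⨅ i, UniformSpace.comap (evalRep f i) inferInstance

instance : IsUniformAddGroup (WithReps f) :=
  isUniformAddGroup_iInf fun i => IsUniformAddGroup.comap (evalRep f i)

theorem continuous_evalRep (i : ι) : Continuous (evalRep f i) := by
  rw [continuous_iff_le_induced, UniformSpace.toTopologicalSpace_iInf]
  exact iInf_le _ i

theorem continuous_withReps_iff {X : Type*} [TopologicalSpace X] {g : X → WithReps f} :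
    Continuous g ↔ ∀ i, Continuous fun x => evalRep f i (g x) := by
  refine ⟨fun h i => (continuous_evalRep f i).comp h, fun h => ?_⟩
  rw [UniformSpace.toTopologicalSpace_iInf, continuous_iInf_rng]
  exact fun i => continuous_induced_rng.2 (h i)

instance : IsTopologicalRing (WithReps f) where
  continuous_add := continuous_add
  continuous_mul := (continuous_withReps_iff f).2 fun i => by
    simp only [map_mul]
    exact ((continuous_evalRep f i).comp continuous_fst).mul
      ((continuous_evalRep f i).comp continuous_snd)
  continuous_neg := continuous_neg

instance : ContinuousStar (WithReps f) where
  continuous_star := (continuous_withReps_iff f).2 fun i => by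
    simp only [map_star]
    exact (continuous_evalRep f i).star

instance : UniformContinuousConstSMul ℂ (WithReps f) where
  uniformContinuous_const_smul c :=
    uniformContinuous_addMonoidHom_of_continuous (f := DistribSMul.toAddMonoidHom (WithReps f) c)
      ((continuous_withReps_iff f).2 fun i => by
        simp only [DistribSMul.toAddMonoidHom_apply, map_smul]
        exact (continuous_evalRep f i).const_smul c)

/-- The Hausdorff completion of `F` for the topology given by the seminorms `x ↦ ‖f i x‖`. -/
def RepCompletion : Type u := Completion (WithReps f)

instance : UniformSpace (RepCompletion f) := inferInstanceAs (UniformSpace (Completion _))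
instance : CompleteSpace (RepCompletion f) := inferInstanceAs (CompleteSpace (Completion _))
instance : T0Space (RepCompletion f) := inferInstanceAs (T0Space (Completion _))
instance : Ring (RepCompletion f) := inferInstanceAs (Ring (Completion (WithReps f)))
instance : StarRing (RepCompletion f) := inferInstanceAs (StarRing (Completion (WithReps f)))
instance : Algebra ℂ (RepCompletion f) := inferInstanceAs (Algebra ℂ (Completion (WithReps f)))
instance : StarModule ℂ (RepCompletion f) :=
  inferInstanceAs (StarModule ℂ (Completion (WithReps f)))
instance : IsUniformAddGroup (RepCompletion f) :=
  inferInstanceAs (IsUniformAddGroup (Completion (WithReps f)))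
instance : IsTopologicalRing (RepCompletion f) :=
  inferInstanceAs (IsTopologicalRing (Completion (WithReps f)))
instance : ContinuousStar (RepCompletion f) :=
  inferInstanceAs (ContinuousStar (Completion (WithReps f)))

/-- The canonical map of `F` into its completion. -/
def RepCompletion.of : F →⋆ₐ[ℂ] RepCompletion f where
  toFun x := ((toReps f x : WithReps f) : Completion (WithReps f))
  map_one' := by rw [map_one]; exact coe_one _
  map_mul' x y := by rw [map_mul]; exact coe_mul _ _
  map_zero' := by rw [map_zero]; exact coe_zero
  map_add' x y := by rw [map_add]; exact coe_add _ _
  commutes' _ := rfl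
  map_star' x := by rw [map_star]; exact coe_star _

theorem RepCompletion.dense_range_of : DenseRange (RepCompletion.of f) :=
  Completion.denseRange_coe (α := WithReps f)

variable {G : Type u} [Ring G] [StarRing G] [Algebra ℂ G] [StarModule ℂ G]
  {κ : Type v} {K : κ → Type w} [∀ i, NormedAddCommGroup (K i)]
  [∀ i, InnerProductSpace ℂ (K i)] [∀ i, CompleteSpace (K i)]
  (g : ∀ i, G →⋆ₐ[ℂ] (K i →L[ℂ] K i))

/-- A `*`-homomorphism that is continuous for the two topologies extends to the completions. -/
def RepCompletion.map (h : F →⋆ₐ[ℂ] G)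
    (hc : ∀ j, Continuous fun x : WithReps f => g j (h x)) :
    RepCompletion f →⋆ₐ[ℂ] RepCompletion g :=
  let h' : WithReps f →⋆ₐ[ℂ] WithReps g := h
  have hc' : Continuous h' := (continuous_withReps_iff g).2 hc
  have hu : UniformContinuous h' :=
    uniformContinuous_addMonoidHom_of_continuous (f := (h' : WithReps f →+ WithReps g)) hc'
  { mapRingHom (h' : WithReps f →+* WithReps g) hc' with
    commutes' := fun c => by
      change Completion.map h' ((algebraMap ℂ (WithReps f) c : WithReps f) : Completion _) = _
      rw [Completion.map_coe hu, AlgHomClass.commutes]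
      rfl
    map_star' := fun x => by
      change Completion.map h' (star x : Completion (WithReps f)) = 
        star (Completion.map h' x : Completion (WithReps g))
      refine Completion.induction_on x (isClosed_eq
        (Completion.continuous_map.comp continuous_star) Completion.continuous_map.star)
        fun a => ?_
      rw [← coe_star, Completion.map_coe hu, Completion.map_coe hu, map_star, coe_star] }

theorem RepCompletion.continuous_map (h : F →⋆ₐ[ℂ] G)
    (hc : ∀ j, Continuous fun x : WithReps f => g j (h x)) :
    Continuous (RepCompletion.map f g h hc) :=
  Completion.continuous_map

theorem RepCompletion.map_of (h : F →⋆ₐ[ℂ] G)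
    (hc : ∀ j, Continuous fun x : WithReps f => g j (h x)) (x : F) :
    RepCompletion.map f g h hc (RepCompletion.of f x) = RepCompletion.of g (h x) :=
  Completion.map_coe (uniformContinuous_addMonoidHom_of_continuous
    (f := ((show WithReps f →⋆ₐ[ℂ] WithReps g from h) : WithReps f →+ WithReps g))
    ((continuous_withReps_iff g).2 hc)) _

end Reps

/-! ### Homomorphisms out of algebraic tensor products -/

section LiftCommute

variable {A B : Type u} [Ring A] [StarRing A] [Algebra ℂ A] [StarModule ℂ A]
  [Ring B] [StarRing B] [Algebra ℂ B] [StarModule ℂ B]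
  {C : Type v} [Semiring C] [StarRing C] [Algebra ℂ C]

/-- The `*`-homomorphism `a ⊗ b ↦ φ(a) ψ(b)` given by two `*`-homomorphisms with commuting
ranges. -/
def liftCommute (φ : A →⋆ₐ[ℂ] C) (ψ : B →⋆ₐ[ℂ] C) (h : ∀ a b, Commute (φ a) (ψ b)) :
    A ⊗[ℂ] B →⋆ₐ[ℂ] C :=
  { Algebra.TensorProduct.lift (φ : A →ₐ[ℂ] C) (ψ : B →ₐ[ℂ] C) h with
    map_star' := fun x => by
      change Algebra.TensorProduct.lift (φ : A →ₐ[ℂ] C) (ψ : B →ₐ[ℂ] C) h (star x) =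
        star (Algebra.TensorProduct.lift (φ : A →ₐ[ℂ] C) (ψ : B →ₐ[ℂ] C) h x)
      induction x using TensorProduct.induction_on with
      | zero => rw [star_zero, map_zero, star_zero]
      | add x y hx hy => rw [star_add, map_add, hx, hy, map_add, star_add]
      | tmul a b =>
        rw [TensorProduct.star_tmul, Algebra.TensorProduct.lift_tmul,
          Algebra.TensorProduct.lift_tmul, star_mul]
        simp only [StarAlgHom.coe_toAlgHom, map_star]
        rw [← star_mul, ← star_mul, (h a b).eq] }

theorem liftCommute_tmul (φ : A →⋆ₐ[ℂ] C) (ψ : B →⋆ₐ[ℂ] C) (h : ∀ a b, Commute (φ a) (ψ b))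
    (a : A) (b : B) : liftCommute φ ψ h (a ⊗ₜ b) = φ a * ψ b :=
  Algebra.TensorProduct.lift_tmul (φ : A →ₐ[ℂ] C) (ψ : B →ₐ[ℂ] C) h a b

end LiftCommute

/-! ### Tensor products of operators and of representations on Hilbert spaces -/

section Hilbert

variable (H : Type u) [NormedAddCommGroup H] [InnerProductSpace ℂ H] [CompleteSpace H]
  (K : Type u) [NormedAddCommGroup K] [InnerProductSpace ℂ K] [CompleteSpace K]

/-- The Hilbert space tensor product. -/
abbrev HilbertTensor : Type u := Completion (H ⊗[ℂ] K)

variable {H K}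

/-- The operator `S ⊗ T` on the Hilbert space tensor product. -/
def opTensor (S : H →L[ℂ] H) (T : K →L[ℂ] K) : HilbertTensor H K →L[ℂ] HilbertTensor H K :=
  (TensorProduct.mapL S T).completion

theorem opTensor_coe (S : H →L[ℂ] H) (T : K →L[ℂ] K) (x : H ⊗[ℂ] K) :
    opTensor S T (x : HilbertTensor H K) = (TensorProduct.mapL S T x : H ⊗[ℂ] K) :=
  ContinuousLinearMap.completion_apply_coe _ _

theorem clm_ext {S T : HilbertTensor H K →L[ℂ] HilbertTensor H K}
    (h : ∀ x : H ⊗[ℂ] K, S (x : HilbertTensor H K) = T (x : HilbertTensor H K)) : S = T :=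
  ContinuousLinearMap.ext fun y => Completion.induction_on y
    (isClosed_eq S.continuous T.continuous) h

theorem opTensor_one : opTensor (1 : H →L[ℂ] H) (1 : K →L[ℂ] K) = 1 :=
  clm_ext fun x => by
    rw [opTensor_coe, one_apply_eq_self]
    exact congrArg _ (by simp [ContinuousLinearMap.one_def])

theorem opTensor_mul (S S' : H →L[ℂ] H) (T T' : K →L[ℂ] K) :
    opTensor (S * S') (T * T') = opTensor S T * opTensor S' T' :=
  clm_ext fun x => by
    rw [mul_apply_eq_comp, opTensor_coe, opTensor_coe, opTensor_coe,
      TensorProduct.mapL_mul, mul_apply_eq_comp]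

theorem inner_mapL (S : H →L[ℂ] H) (T : K →L[ℂ] K) (x y : H ⊗[ℂ] K) :
    inner ℂ (TensorProduct.mapL (star S) (star T) x) y
      = inner ℂ x (TensorProduct.mapL S T y) := by
  induction x using TensorProduct.induction_on with
  | zero => simp
  | add x x' hx hx' => simp only [map_add, inner_add_left, hx, hx']
  | tmul a b =>
    induction y using TensorProduct.induction_on with
    | zero => simp
    | add y y' hy hy' => simp only [map_add, inner_add_right, hy, hy']
    | tmul c d =>
      simp [ContinuousLinearMap.star_eq_adjoint, ContinuousLinearMap.adjoint_inner_left]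

theorem opTensor_star (S : H →L[ℂ] H) (T : K →L[ℂ] K) :
    opTensor (star S) (star T) = star (opTensor S T) := by
  rw [ContinuousLinearMap.star_eq_adjoint (opTensor S T), ContinuousLinearMap.eq_adjoint_iff]
  intro x y
  refine Completion.induction_on₂ x y (isClosed_eq ?_ ?_) fun a b => ?_
  · exact ((opTensor (star S) (star T)).continuous.comp continuous_fst).inner continuous_snd
  · exact continuous_fst.inner ((opTensor S T).continuous.comp continuous_snd)
  · rw [opTensor_coe, opTensor_coe, Completion.inner_coe, Completion.inner_coe, inner_mapL]

variable (H K) in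
/-- The amplification `S ↦ S ⊗ 1`. -/
def ampLeft : (H →L[ℂ] H) →⋆ₐ[ℂ] (HilbertTensor H K →L[ℂ] HilbertTensor H K) where
  toFun S := opTensor S 1
  map_one' := opTensor_one
  map_mul' S S' := by rw [← opTensor_mul, one_mul]
  map_zero' := clm_ext fun x => by rw [opTensor_coe]; simp
  map_add' S S' := clm_ext fun x => by
    rw [_root_.add_apply, opTensor_coe, opTensor_coe, opTensor_coe,
      TensorProduct.mapL_add_left, _root_.add_apply, coe_add]
  commutes' c := clm_ext fun x => by
    rw [opTensor_coe, Algebra.algebraMap_eq_smul_one, Algebra.algebraMap_eq_smul_one,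
      TensorProduct.mapL_smul_left, _root_.smul_apply,
      _root_.smul_apply, one_apply_eq_self, coe_smul]
    simp [ContinuousLinearMap.one_def]
  map_star' S := by rw [← opTensor_star, star_one]

variable (H K) in
/-- The amplification `T ↦ 1 ⊗ T`. -/
def ampRight : (K →L[ℂ] K) →⋆ₐ[ℂ] (HilbertTensor H K →L[ℂ] HilbertTensor H K) where
  toFun T := opTensor 1 T
  map_one' := opTensor_one
  map_mul' S S' := by rw [← opTensor_mul, one_mul]
  map_zero' := clm_ext fun x => by rw [opTensor_coe]; simp
  map_add' S S' := clm_ext fun x => by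
    rw [_root_.add_apply, opTensor_coe, opTensor_coe, opTensor_coe,
      TensorProduct.mapL_add_right, _root_.add_apply, coe_add]
  commutes' c := clm_ext fun x => by
    rw [opTensor_coe, Algebra.algebraMap_eq_smul_one, Algebra.algebraMap_eq_smul_one,
      TensorProduct.mapL_smul_right, _root_.smul_apply,
      _root_.smul_apply, one_apply_eq_self, coe_smul]
    simp [ContinuousLinearMap.one_def]
  map_star' S := by rw [← opTensor_star, star_one]

theorem ampLeft_mul_ampRight (S : H →L[ℂ] H) (T : K →L[ℂ] K) :
    ampLeft H K S * ampRight H K T = opTensor S T := by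
  change opTensor S 1 * opTensor 1 T = _
  rw [← opTensor_mul, mul_one, one_mul]

theorem ampRight_mul_ampLeft (S : H →L[ℂ] H) (T : K →L[ℂ] K) :
    ampRight H K T * ampLeft H K S = opTensor S T := by
  change opTensor 1 T * opTensor S 1 = _
  rw [← opTensor_mul, mul_one, one_mul]

variable {A B : Type u} [Ring A] [StarRing A] [Algebra ℂ A] [StarModule ℂ A]
  [Ring B] [StarRing B] [Algebra ℂ B] [StarModule ℂ B]

/-- The tensor product `π ⊗ ρ` of two `*`-representations, `(π ⊗ ρ)(a ⊗ b) = π(a) ⊗ ρ(b)`. -/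
def tensorRep (π : A →⋆ₐ[ℂ] (H →L[ℂ] H)) (ρ : B →⋆ₐ[ℂ] (K →L[ℂ] K)) :
    A ⊗[ℂ] B →⋆ₐ[ℂ] (HilbertTensor H K →L[ℂ] HilbertTensor H K) :=
  liftCommute (C := HilbertTensor H K →L[ℂ] HilbertTensor H K) ((ampLeft H K).comp π) ((ampRight H K).comp ρ)
    fun a b => (ampLeft_mul_ampRight (π a) (ρ b)).trans (ampRight_mul_ampLeft (π a) (ρ b)).symm

theorem tensorRep_tmul (π : A →⋆ₐ[ℂ] (H →L[ℂ] H)) (ρ : B →⋆ₐ[ℂ] (K →L[ℂ] K)) (a : A) (b : B) :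
    tensorRep π ρ (a ⊗ₜ b) = opTensor (π a) (ρ b) :=
  (liftCommute_tmul (C := HilbertTensor H K →L[ℂ] HilbertTensor H K) _ _ _ a b).trans (ampLeft_mul_ampRight (π a) (ρ b))

end Hilbert

section AlgMap

variable {A B C D : Type u}
  [Ring A] [StarRing A] [Algebra ℂ A] [StarModule ℂ A]
  [Ring B] [StarRing B] [Algebra ℂ B] [StarModule ℂ B]
  [Ring C] [StarRing C] [Algebra ℂ C] [StarModule ℂ C]
  [Ring D] [StarRing D] [Algebra ℂ D] [StarModule ℂ D]

/-- The homomorphism `a ↦ a ⊗ 1`. -/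
def inclLeft : A →⋆ₐ[ℂ] A ⊗[ℂ] B where
  __ := (Algebra.TensorProduct.includeLeft : A →ₐ[ℂ] A ⊗[ℂ] B)
  map_star' a := by
    change (star a ⊗ₜ[ℂ] (1 : B)) = star (a ⊗ₜ[ℂ] (1 : B))
    rw [TensorProduct.star_tmul, star_one]

/-- The homomorphism `b ↦ 1 ⊗ b`. -/
def inclRight : B →⋆ₐ[ℂ] A ⊗[ℂ] B where
  __ := (Algebra.TensorProduct.includeRight : B →ₐ[ℂ] A ⊗[ℂ] B)
  map_star' b := by
    change ((1 : A) ⊗ₜ[ℂ] star b) = star ((1 : A) ⊗ₜ[ℂ] b)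
    rw [TensorProduct.star_tmul, star_one]

/-- The homomorphism `a ⊗ b ↦ f(a) ⊗ g(b)` between algebraic tensor products. -/
def algMap (f : A →⋆ₐ[ℂ] C) (g : B →⋆ₐ[ℂ] D) : A ⊗[ℂ] B →⋆ₐ[ℂ] C ⊗[ℂ] D where
  __ := Algebra.TensorProduct.map (f : A →ₐ[ℂ] C) (g : B →ₐ[ℂ] D)
  map_star' x := by
    change Algebra.TensorProduct.map (f : A →ₐ[ℂ] C) (g : B →ₐ[ℂ] D) (star x)
      = star (Algebra.TensorProduct.map (f : A →ₐ[ℂ] C) (g : B →ₐ[ℂ] D) x)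
    induction x using TensorProduct.induction_on with
    | zero => rw [star_zero, map_zero, star_zero]
    | add x y hx hy => rw [star_add, map_add, hx, hy, map_add, star_add]
    | tmul a b => simp [TensorProduct.star_tmul, map_star]

theorem algMap_tmul (f : A →⋆ₐ[ℂ] C) (g : B →⋆ₐ[ℂ] D) (a : A) (b : B) :
    algMap f g (a ⊗ₜ b) = f a ⊗ₜ g b := rfl

theorem tensorRep_algMap {H K : Type u} [NormedAddCommGroup H] [InnerProductSpace ℂ H]
    [CompleteSpace H] [NormedAddCommGroup K] [InnerProductSpace ℂ K] [CompleteSpace K]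
    (π : C →⋆ₐ[ℂ] (H →L[ℂ] H)) (ρ : D →⋆ₐ[ℂ] (K →L[ℂ] K))
    (f : A →⋆ₐ[ℂ] C) (g : B →⋆ₐ[ℂ] D) (x : A ⊗[ℂ] B) :
    tensorRep π ρ (algMap f g x) = tensorRep (π.comp f) (ρ.comp g) x := by
  induction x using TensorProduct.induction_on with
  | zero => rw [map_zero, map_zero, map_zero]
  | add x y hx hy => rw [map_add, map_add, hx, hy, map_add]
  | tmul a b => rw [algMap_tmul, tensorRep_tmul, tensorRep_tmul]; rfl

end AlgMap

/-! ### The minimal tensor product of topological star algebras -/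

section MinTensor

/-- A continuous unital `*`-representation of a topological star algebra on a Hilbert space. -/
structure Rep (A : Type u) [Ring A] [StarRing A] [Algebra ℂ A] [TopologicalSpace A] where
  H : Type u
  [normed : NormedAddCommGroup H]
  [inner : InnerProductSpace ℂ H]
  [complete : CompleteSpace H]
  π : A →⋆ₐ[ℂ] (H →L[ℂ] H)
  continuous_π : Continuous π

attribute [instance] Rep.normed Rep.inner Rep.complete

variable (A B C D : Type u)
  [Ring A] [StarRing A] [Algebra ℂ A] [StarModule ℂ A] [TopologicalSpace A]
  [Ring B] [StarRing B] [Algebra ℂ B] [StarModule ℂ B] [TopologicalSpace B]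
  [Ring C] [StarRing C] [Algebra ℂ C] [StarModule ℂ C] [TopologicalSpace C]
  [Ring D] [StarRing D] [Algebra ℂ D] [StarModule ℂ D] [TopologicalSpace D]

/-- The representations `π ⊗ ρ` of the algebraic tensor product `A ⊗ B`. -/
abbrev pairRep (p : Rep A × Rep B) :
    A ⊗[ℂ] B →⋆ₐ[ℂ] (HilbertTensor p.1.H p.2.H →L[ℂ] HilbertTensor p.1.H p.2.H) :=
  tensorRep p.1.π p.2.π

/-- The minimal (spatial) tensor product: the Hausdorff completion of the algebraic tensor product
for the topology given by the seminorms `x ↦ ‖(π ⊗ ρ) x‖`, where `π` and `ρ` run through the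
continuous `*`-representations of the factors on Hilbert spaces. If `A` and `B` are C⋆-algebras
this is the topology of the minimal C⋆-norm, as `‖x‖_min = ‖(π ⊗ ρ) x‖` for faithful `π`, `ρ`, and
`‖(π ⊗ ρ) x‖ ≤ ‖x‖_min` for all `π`, `ρ`. -/
abbrev MinTensor : Type u :=
  RepCompletion (F := A ⊗[ℂ] B) (H := fun p : Rep A × Rep B => HilbertTensor p.1.H p.2.H)
    (pairRep A B)

/-- The representations `(π ⊗ ρ) ⊗ σ` of the algebraic tensor product `(A ⊗ B) ⊗ C`. -/
abbrev tripleRep (p : Rep A × Rep B × Rep C) :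
    (A ⊗[ℂ] B) ⊗[ℂ] C →⋆ₐ[ℂ]
      (HilbertTensor (HilbertTensor p.1.H p.2.1.H) p.2.2.H →L[ℂ]
        HilbertTensor (HilbertTensor p.1.H p.2.1.H) p.2.2.H) :=
  tensorRep (tensorRep p.1.π p.2.1.π) p.2.2.π

/-- The minimal (spatial) tensor product of three factors. -/
abbrev MinTensor₃ : Type u := RepCompletion (tripleRep A B C)

variable {A B C D}

/-- The elementary tensor `a ⊗ b`. -/
def tmul (a : A) (b : B) : MinTensor A B := RepCompletion.of (pairRep A B) (a ⊗ₜ b)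

theorem continuous_tensorRep {H K : Type u} [NormedAddCommGroup H] [InnerProductSpace ℂ H]
    [CompleteSpace H] [NormedAddCommGroup K] [InnerProductSpace ℂ K] [CompleteSpace K]
    (π : A →⋆ₐ[ℂ] (H →L[ℂ] H)) (hπ : Continuous π) (ρ : B →⋆ₐ[ℂ] (K →L[ℂ] K))
    (hρ : Continuous ρ) : Continuous fun x : WithReps (pairRep A B) => tensorRep π ρ x :=
  continuous_evalRep (pairRep A B) (⟨H, π, hπ⟩, ⟨K, ρ, hρ⟩)

theorem continuous_ampLeft (H K : Type u) [NormedAddCommGroup H] [InnerProductSpace ℂ H]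
    [CompleteSpace H] [NormedAddCommGroup K] [InnerProductSpace ℂ K] [CompleteSpace K] :
    Continuous (ampLeft H K) :=
  map_continuous (ampLeft H K)

theorem continuous_ampRight (H K : Type u) [NormedAddCommGroup H] [InnerProductSpace ℂ H]
    [CompleteSpace H] [NormedAddCommGroup K] [InnerProductSpace ℂ K] [CompleteSpace K] :
    Continuous (ampRight H K) :=
  map_continuous (ampRight H K)

/-- The tensor product `f ⊗ g` of two continuous `*`-homomorphisms. -/
def MinTensor.map (f : A →⋆ₐ[ℂ] C) (hf : Continuous f) (g : B →⋆ₐ[ℂ] D) (hg : Continuous g) :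
    MinTensor A B →⋆ₐ[ℂ] MinTensor C D :=
  RepCompletion.map (pairRep A B) (pairRep C D) (algMap f g) fun j =>
    (continuous_tensorRep (j.1.π.comp f) (j.1.continuous_π.comp hf) (j.2.π.comp g)
      (j.2.continuous_π.comp hg)).congr fun x => (tensorRep_algMap j.1.π j.2.π f g x).symm

theorem MinTensor.map_tmul (f : A →⋆ₐ[ℂ] C) (hf : Continuous f) (g : B →⋆ₐ[ℂ] D)
    (hg : Continuous g) (a : A) (b : B) :
    MinTensor.map f hf g hg (tmul a b) = tmul (f a) (g b) :=
  RepCompletion.map_of _ _ _ _ _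

variable (A B C)

/-- The homomorphism `x ↦ x ⊗ 1` from `A ⊗ B` to `A ⊗ B ⊗ C`. -/
def leg₁₂ : MinTensor A B →⋆ₐ[ℂ] MinTensor₃ A B C :=
  RepCompletion.map (pairRep A B) (tripleRep A B C) inclLeft fun j => by
    refine ((continuous_ampLeft (HilbertTensor j.1.H j.2.1.H) j.2.2.H).comp
      (continuous_tensorRep j.1.π j.1.continuous_π j.2.1.π j.2.1.continuous_π)).congr fun x => ?_
    refine Eq.trans ?_ (tensorRep_tmul (tensorRep j.1.π j.2.1.π) j.2.2.π _ _).symm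
    rw [map_one]
    rfl

/-- The homomorphism `x ↦ 1 ⊗ x` from `B ⊗ C` to `A ⊗ B ⊗ C`. -/
def leg₂₃ : MinTensor B C →⋆ₐ[ℂ] MinTensor₃ A B C :=
  RepCompletion.map (pairRep B C) (tripleRep A B C) (algMap inclRight (StarAlgHom.id ℂ C))
    fun j => by
      have hc : Continuous fun b : B => (tensorRep j.1.π j.2.1.π) (inclRight b) := by
        refine ((continuous_ampRight j.1.H j.2.1.H).comp j.2.1.continuous_π).congr fun b => ?_
        refine Eq.trans ?_ (tensorRep_tmul j.1.π j.2.1.π _ _).symm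
        rw [map_one]
        rfl
      refine (continuous_tensorRep (A := B) (B := C) ((tensorRep j.1.π j.2.1.π).comp inclRight) hc
        j.2.2.π j.2.2.continuous_π).congr fun x => ?_
      exact (tensorRep_algMap (tensorRep j.1.π j.2.1.π) j.2.2.π inclRight
        (StarAlgHom.id ℂ C) x).symm

/-- The homomorphism `a ↦ a ⊗ 1 ⊗ 1`. -/
def leg₁ : A →⋆ₐ[ℂ] MinTensor₃ A B C :=
  (RepCompletion.of (tripleRep A B C)).comp (inclLeft.comp inclLeft)

/-- The homomorphism `c ↦ 1 ⊗ 1 ⊗ c`. -/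
def leg₃ : C →⋆ₐ[ℂ] MinTensor₃ A B C :=
  (RepCompletion.of (tripleRep A B C)).comp inclRight

variable {A B C}

theorem leg₁₂_of (x : A ⊗[ℂ] B) :
    leg₁₂ A B C (RepCompletion.of _ x) = RepCompletion.of (tripleRep A B C) (x ⊗ₜ 1) :=
  RepCompletion.map_of _ _ _ _ _

theorem leg₂₃_of (x : B ⊗[ℂ] C) :
    leg₂₃ A B C (RepCompletion.of _ x) =
      RepCompletion.of (tripleRep A B C) (algMap inclRight (StarAlgHom.id ℂ C) x) :=
  RepCompletion.map_of _ _ _ _ _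

theorem leg₁₂_commute_leg₃ (x : MinTensor A B) (c : C) :
    Commute (leg₁₂ A B C x) (leg₃ A B C c) := by
  have hcont : Continuous (leg₁₂ A B C) := RepCompletion.continuous_map _ _ _ _
  refine (RepCompletion.dense_range_of (pairRep A B)).induction_on
    (p := fun x => Commute (leg₁₂ A B C x) (leg₃ A B C c)) x
    (isClosed_eq (hcont.mul continuous_const) (continuous_const.mul hcont)) fun a => ?_
  rw [leg₁₂_of, leg₃]
  refine Commute.map (f := RepCompletion.of (tripleRep A B C)) (x := a ⊗ₜ[ℂ] (1 : C))
    (y := (1 : A ⊗[ℂ] B) ⊗ₜ[ℂ] c) ?_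
  simp [Commute, SemiconjBy, Algebra.TensorProduct.tmul_mul_tmul]

theorem leg₁_commute_leg₂₃ (a : A) (x : MinTensor B C) :
    Commute (leg₁ A B C a) (leg₂₃ A B C x) := by
  have hcont : Continuous (leg₂₃ A B C) := RepCompletion.continuous_map _ _ _ _
  refine (RepCompletion.dense_range_of (pairRep B C)).induction_on
    (p := fun x => Commute (leg₁ A B C a) (leg₂₃ A B C x)) x
    (isClosed_eq (continuous_const.mul hcont) (hcont.mul continuous_const)) fun y => ?_
  rw [leg₂₃_of, leg₁]
  refine Commute.map (f := RepCompletion.of (tripleRep A B C))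
    (x := (a ⊗ₜ[ℂ] (1 : B)) ⊗ₜ[ℂ] (1 : C)) ?_
  induction y using TensorProduct.induction_on with
  | zero => rw [map_zero]; exact Commute.zero_right _
  | add y z hy hz => rw [map_add]; exact hy.add_right hz
  | tmul b c =>
    change Commute _ (((1 : A) ⊗ₜ[ℂ] b) ⊗ₜ[ℂ] c)
    simp [Commute, SemiconjBy, Algebra.TensorProduct.tmul_mul_tmul]

/-- The homomorphism `a ⊗ b ↦ Δ(a) ⊗ b` on the algebraic tensor product. -/
def comulIdAlg (Δ : A →⋆ₐ[ℂ] MinTensor A A) : A ⊗[ℂ] A →⋆ₐ[ℂ] MinTensor₃ A A A :=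
  liftCommute ((leg₁₂ A A A).comp Δ) (leg₃ A A A) fun a b => leg₁₂_commute_leg₃ (Δ a) b

/-- The homomorphism `a ⊗ b ↦ a ⊗ Δ(b)` on the algebraic tensor product. -/
def idComulAlg (Δ : A →⋆ₐ[ℂ] MinTensor A A) : A ⊗[ℂ] A →⋆ₐ[ℂ] MinTensor₃ A A A :=
  liftCommute (leg₁ A A A) ((leg₂₃ A A A).comp Δ) fun a b => leg₁_commute_leg₂₃ a (Δ b)

/-- The map `Δ ⊗ id`: the extension of `a ⊗ b ↦ Δ(a) ⊗ b` by continuity. -/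
def comulId (Δ : A →⋆ₐ[ℂ] MinTensor A A) : MinTensor A A → MinTensor₃ A A A :=
  Completion.extension (α := WithReps (pairRep A A)) (comulIdAlg Δ)

/-- The map `id ⊗ Δ`: the extension of `a ⊗ b ↦ a ⊗ Δ(b)` by continuity. -/
def idComul (Δ : A →⋆ₐ[ℂ] MinTensor A A) : MinTensor A A → MinTensor₃ A A A :=
  Completion.extension (α := WithReps (pairRep A A)) (idComulAlg Δ)

end MinTensor

/-! ### σ-C⋆-algebras and quantum groups -/

section QuantumGroup

/-- The inverse limit, in the category of topological star algebras, of a sequence of C⋆-algebras: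
the algebra of all coherent sequences with the topology of the product. -/
def inverseLimit {A : ℕ → Type u} [∀ n, CStarAlgebra (A n)] (θ : ∀ n, A (n + 1) →⋆ₐ[ℂ] A n) :
    StarSubalgebra ℂ (∀ n, A n) where
  carrier := {a | ∀ n, θ n (a (n + 1)) = a n}
  mul_mem' ha hb n := by simp [ha n, hb n]
  add_mem' ha hb n := by simp [ha n, hb n]
  algebraMap_mem' c n := by simp [Pi.algebraMap_apply, AlgHomClass.commutes]
  star_mem' ha n := by simp [map_star, ha n]

/-- The canonical projection of the inverse limit. -/
def proj {A : ℕ → Type u} [∀ n, CStarAlgebra (A n)] (θ : ∀ n, A (n + 1) →⋆ₐ[ℂ] A n) (n : ℕ) :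
    inverseLimit θ →⋆ₐ[ℂ] A n where
  toFun a := a.1 n
  map_one' := rfl
  map_mul' _ _ := rfl
  map_zero' := rfl
  map_add' _ _ := rfl
  commutes' _ := rfl
  map_star' _ := rfl

theorem continuous_proj {A : ℕ → Type u} [∀ n, CStarAlgebra (A n)]
    (θ : ∀ n, A (n + 1) →⋆ₐ[ℂ] A n) (n : ℕ) : Continuous (proj θ n) :=
  (continuous_apply n).comp continuous_subtype_val

variable (A : Type u) [Ring A] [StarRing A] [Algebra ℂ A] [StarModule ℂ A] [TopologicalSpace A]

/-- A unital σ-C⋆-algebra: a topological star algebra isomorphic to the inverse limit of a sequence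
of C⋆-algebras. -/
def IsSigmaCStarAlgebra : Prop :=
  ∃ (B : ℕ → Type u) (_ : ∀ n, CStarAlgebra (B n)) (θ : ∀ n, B (n + 1) →⋆ₐ[ℂ] B n)
    (e : A ≃⋆ₐ[ℂ] inverseLimit θ), Continuous e ∧ Continuous e.symm

variable {A}

/-- The axioms of a comultiplication: coassociativity `(Δ ⊗ id)Δ = (id ⊗ Δ)Δ`, and density of the
linear spans of `Δ(A)(A ⊗ 1)` and of `Δ(A)(1 ⊗ A)` in `A ⊗ A`. -/
def IsComultiplication (Δ : A →⋆ₐ[ℂ] MinTensor A A) : Prop :=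
  (∀ a, comulId Δ (Δ a) = idComul Δ (Δ a)) ∧
  Dense (Submodule.span ℂ {x | ∃ a b, x = Δ a * tmul b 1} : Set (MinTensor A A)) ∧
  Dense (Submodule.span ℂ {x | ∃ a b, x = Δ a * tmul 1 b} : Set (MinTensor A A))

/-- `(A, Δ)` is a C⋆-compact quantum group. -/
def IsCompactQuantumGroup (A : Type u) [CStarAlgebra A] (Δ : A →⋆ₐ[ℂ] MinTensor A A) : Prop :=
  IsComultiplication Δ

/-- `(A, Δ)` is a σ-C⋆-quantum group. Continuity of `Δ`, which is automatic for `*`-homomorphisms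
out of a σ-C⋆-algebra, is made explicit. -/
def IsSigmaCStarQuantumGroup (A : Type u) [Ring A] [StarRing A] [Algebra ℂ A]
    [StarModule ℂ A] [TopologicalSpace A] (Δ : A →⋆ₐ[ℂ] MinTensor A A) : Prop :=
  IsSigmaCStarAlgebra A ∧ Continuous Δ ∧ IsComultiplication Δ

section Systems

variable {A : ℕ → Type u} [∀ n, CStarAlgebra (A n)] (θ : ∀ n, A (n + 1) →⋆ₐ[ℂ] A n)

/-- Continuity of the connecting homomorphisms, which is automatic. -/
theorem continuous_connecting (n : ℕ) : Continuous (θ n) :=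
  AddMonoidHomClass.continuous_of_bound (θ n) 1 fun x => by
    simpa using NonUnitalStarAlgHom.norm_apply_le (θ n) x

/-- The connecting homomorphism `θ_n ⊗ θ_n`. -/
def tensorConnecting (n : ℕ) :
    MinTensor (A (n + 1)) (A (n + 1)) →⋆ₐ[ℂ] MinTensor (A n) (A n) :=
  MinTensor.map (θ n) (continuous_connecting θ n) (θ n) (continuous_connecting θ n)

/-- The homomorphism `p_n ⊗ p_n`, where `p_n` is the projection of the inverse limit. -/
def tensorProj (n : ℕ) :
    MinTensor (inverseLimit θ) (inverseLimit θ) →⋆ₐ[ℂ] MinTensor (A n) (A n) :=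
  MinTensor.map (proj θ n) (continuous_proj θ n) (proj θ n) (continuous_proj θ n)

/-- The homomorphisms `Δ_n` form a morphism of inverse systems `{A_n} → {A_n ⊗ A_n}`. -/
def IsSystemMorphism (Δ : ∀ n, A n →⋆ₐ[ℂ] MinTensor (A n) (A n)) : Prop :=
  ∀ n a, tensorConnecting θ n (Δ (n + 1) a) = Δ n (θ n a)

/-- The homomorphism `Δlim` is the inverse limit of the homomorphisms `Δ_n`. -/
def IsLimitHom (Δ : ∀ n, A n →⋆ₐ[ℂ] MinTensor (A n) (A n))
    (Δlim : inverseLimit θ →⋆ₐ[ℂ] MinTensor (inverseLimit θ) (inverseLimit θ)) : Prop :=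
  ∀ n a, tensorProj θ n (Δlim a) = Δ n (proj θ n a)

/-- The canonical map identifies `A ⊗ A`, where `A` is the inverse limit of the `A_n`, with the
inverse limit of the `A_n ⊗ A_n`: it is a homeomorphism onto the coherent sequences. -/
def TensorIsInverseLimit : Prop :=
  Topology.IsEmbedding (fun x n => tensorProj θ n x :
      MinTensor (inverseLimit θ) (inverseLimit θ) → ∀ n, MinTensor (A n) (A n)) ∧
    Set.range (fun x n => tensorProj θ n x :
      MinTensor (inverseLimit θ) (inverseLimit θ) → ∀ n, MinTensor (A n) (A n)) =
        {y | ∀ n, tensorConnecting θ n (y (n + 1)) = y n}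

end Systems

end QuantumGroup

/-! ### The universal C⋆-algebra `C(SU_q(n))` -/

section FreeStar

/-- The free unital `*`-algebra on a set `X`: the free algebra on two copies of `X`, the second one
for the formal adjoints. -/
def FreeStar (X : Type) : Type := FreeAlgebra ℂ (X ⊕ X)

variable {X : Type}

instance : Ring (FreeStar X) := inferInstanceAs (Ring (FreeAlgebra ℂ (X ⊕ X)))
instance : Algebra ℂ (FreeStar X) := inferInstanceAs (Algebra ℂ (FreeAlgebra ℂ (X ⊕ X)))

/-- The generators and their formal adjoints. -/
def FreeStar.ι (x : X ⊕ X) : FreeStar X := FreeAlgebra.ι ℂ x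

/-- The opposite algebra of `FreeStar X` with the conjugate scalar multiplication. -/
def FreeStarConj (X : Type) : Type := (FreeStar X)ᵐᵒᵖ

instance : Ring (FreeStarConj X) := inferInstanceAs (Ring (FreeStar X)ᵐᵒᵖ)

instance : Algebra ℂ (FreeStarConj X) :=
  ((algebraMap ℂ (FreeStar X)ᵐᵒᵖ).comp (starRingEnd ℂ)).toAlgebra'
    fun c x => Algebra.commutes (A := (FreeStar X)ᵐᵒᵖ) (starRingEnd ℂ c) x

/-- The involution, as a homomorphism into the conjugate opposite algebra. -/
def freeStarHom (X : Type) : FreeStar X →ₐ[ℂ] FreeStarConj X :=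
  (FreeAlgebra.lift ℂ fun x => (MulOpposite.op (FreeStar.ι x.swap) : (FreeStar X)ᵐᵒᵖ) :
    FreeAlgebra ℂ (X ⊕ X) →ₐ[ℂ] FreeStarConj X)

instance : Star (FreeStar X) := ⟨fun x => MulOpposite.unop (freeStarHom X x)⟩

theorem freeStar_star_mul (x y : FreeStar X) : star (x * y) = star y * star x :=
  congrArg MulOpposite.unop (map_mul (freeStarHom X) x y)

theorem freeStar_star_add (x y : FreeStar X) : star (x + y) = star x + star y :=
  congrArg MulOpposite.unop (map_add (freeStarHom X) x y)

theorem freeStar_star_algebraMap (c : ℂ) :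
    star (algebraMap ℂ (FreeStar X) c) = algebraMap ℂ (FreeStar X) (star c) :=
  congrArg MulOpposite.unop ((freeStarHom X).commutes c)

theorem freeStar_star_ι (x : X ⊕ X) :
    star (FreeStar.ι x) = FreeStar.ι x.swap :=
  congrArg (MulOpposite.unop (α := FreeStar X)) (FreeAlgebra.lift_ι_apply (A := FreeStarConj X)
    (fun x : X ⊕ X => (MulOpposite.op (FreeStar.ι x.swap) : (FreeStar X)ᵐᵒᵖ)) x)

theorem freeStar_induction {P : FreeStar X → Prop} (hc : ∀ c, P (algebraMap ℂ (FreeStar X) c))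
    (hι : ∀ x, P (FreeStar.ι x))
    (hm : ∀ x y, P x → P y → P (x * y)) (ha : ∀ x y, P x → P y → P (x + y)) (x : FreeStar X) :
    P x :=
  FreeAlgebra.induction (motive := P) ℂ (X ⊕ X) hc hι hm ha x

instance : StarRing (FreeStar X) where
  star_involutive x := by
    induction x using freeStar_induction with
    | hc c => rw [freeStar_star_algebraMap, freeStar_star_algebraMap, star_star]
    | hι x => rw [freeStar_star_ι, freeStar_star_ι, Sum.swap_swap]
    | hm x y hx hy => rw [freeStar_star_mul, freeStar_star_mul, hx, hy]
    | ha x y hx hy => rw [freeStar_star_add, freeStar_star_add, hx, hy]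
  star_mul := freeStar_star_mul
  star_add := freeStar_star_add

instance : StarModule ℂ (FreeStar X) where
  star_smul c x := by
    rw [Algebra.smul_def, star_mul, freeStar_star_algebraMap, Algebra.smul_def,
      Algebra.commutes]

/-- The generator belonging to `x`. -/
def FreeStar.gen (x : X) : FreeStar X := FreeStar.ι (Sum.inl x)

/-- The `*`-homomorphism that maps the generators to given elements of a star algebra. -/
def FreeStar.lift {B : Type*} [Ring B] [StarRing B] [Algebra ℂ B] [StarModule ℂ B] (v : X → B) :
    FreeStar X →⋆ₐ[ℂ] B where
  __ := (FreeAlgebra.lift ℂ (Sum.elim v fun x => star (v x)) : FreeAlgebra ℂ (X ⊕ X) →ₐ[ℂ] B)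
  map_star' x := by
    let φ : FreeStar X →ₐ[ℂ] B :=
      (FreeAlgebra.lift ℂ (Sum.elim v fun x => star (v x)) : FreeAlgebra ℂ (X ⊕ X) →ₐ[ℂ] B)
    have hφ : ∀ x, φ (FreeStar.ι x) =
      Sum.elim v (fun x => star (v x)) x := FreeAlgebra.lift_ι_apply _
    change φ (star x) = star (φ x)
    induction x using freeStar_induction with
    | hc c =>
      rw [freeStar_star_algebraMap, AlgHom.commutes, AlgHom.commutes, algebraMap_star_comm]
    | hι x => rw [freeStar_star_ι, hφ, hφ]; cases x <;> simp
    | hm x y hx hy => rw [star_mul, map_mul, map_mul, star_mul, hx, hy]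
    | ha x y hx hy => rw [star_add, map_add, map_add, star_add, hx, hy]

theorem FreeStar.lift_ι {B : Type*} [Ring B] [StarRing B] [Algebra ℂ B] [StarModule ℂ B]
    (v : X → B) (x : X ⊕ X) :
    FreeStar.lift v (FreeStar.ι x) = Sum.elim v (fun x => star (v x)) x :=
  FreeAlgebra.lift_ι_apply (Sum.elim v fun x => star (v x)) x

theorem FreeStar.lift_gen {B : Type*} [Ring B] [StarRing B] [Algebra ℂ B] [StarModule ℂ B]
    (v : X → B) (x : X) : FreeStar.lift v (FreeStar.gen x) = v x :=
  FreeAlgebra.lift_ι_apply (Sum.elim v fun x => star (v x)) (Sum.inl x)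

end FreeStar

section SUq

/-- The number of inversions of a tuple. -/
def inversions {n : ℕ} (i : Fin n → Fin n) : ℕ :=
  (Finset.univ.filter fun p : Fin n × Fin n => p.1 < p.2 ∧ i p.2 < i p.1).card

open Classical in
/-- The coefficient `E_{i₁ … iₙ}`: zero unless the indices are distinct, and then `(-q)^ℓ` with `ℓ`
the number of inversions. -/
def coeffE (q : ℝ) {n : ℕ} (i : Fin n → Fin n) : ℂ :=
  if Function.Injective i then ((-q : ℝ) : ℂ) ^ inversions i else 0

/-- The defining relations of `C(SU_q(n))` for a matrix `u` of elements of a unital star algebra. -/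
structure SUqRelations (q : ℝ) {n : ℕ} {B : Type*} [Ring B] [StarRing B] [Algebra ℂ B]
    (u : Fin n → Fin n → B) : Prop where
  mul_star : ∀ i j, ∑ k, u i k * star (u j k) = if i = j then 1 else 0
  star_mul : ∀ i j, ∑ k, star (u k i) * u k j = if i = j then 1 else 0
  det : ∀ j : Fin n → Fin n,
    ∑ i : Fin n → Fin n, coeffE q i • (List.ofFn fun k => u (j k) (i k)).prod =
      coeffE q j • (1 : B)

theorem SUqRelations.norm_le_one {q : ℝ} {n : ℕ} {B : Type*} [CStarAlgebra B]
    {u : Fin n → Fin n → B} (h : SUqRelations q u) (i j : Fin n) : ‖u i j‖ ≤ 1 := by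
  let _ := CStarAlgebra.spectralOrder B
  let _ := CStarAlgebra.spectralOrderedRing B
  have h1 : u i j * star (u i j) ≤ 1 := by
    have := h.mul_star i i
    rw [if_pos rfl] at this
    rw [← this]
    exact Finset.single_le_sum (f := fun k => u i k * star (u i k))
      (fun k _ => mul_star_self_nonneg _) (Finset.mem_univ j)
  have h2 := CStarAlgebra.norm_le_norm_of_nonneg_of_le (mul_star_self_nonneg (u i j)) h1
  rw [CStarRing.norm_self_mul_star] at h2
  have h3 : ‖(1 : B)‖ ≤ 1 := by
    rcases subsingleton_or_nontrivial B with _ | _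
    · rw [Subsingleton.elim (1 : B) 0, norm_zero]; exact zero_le_one
    · rw [CStarRing.norm_one]
  nlinarith [norm_nonneg (u i j)]

variable (q : ℝ) (n : ℕ)

/-- The free `*`-algebra on the generators `u_{ij}`, to be equipped with the universal
C⋆-seminorm. -/
@[nolint unusedArguments]
def PreSUq (_q : ℝ) (n : ℕ) : Type := FreeStar (Fin n × Fin n)

instance : Ring (PreSUq q n) := inferInstanceAs (Ring (FreeStar (Fin n × Fin n)))
instance : StarRing (PreSUq q n) := inferInstanceAs (StarRing (FreeStar (Fin n × Fin n)))
instance : Algebra ℂ (PreSUq q n) := inferInstanceAs (Algebra ℂ (FreeStar (Fin n × Fin n)))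
instance : StarModule ℂ (PreSUq q n) :=
  inferInstanceAs (StarModule ℂ (FreeStar (Fin n × Fin n)))

variable {q n}

/-- The `*`-homomorphism on the free `*`-algebra that maps the generators to the entries of `u`. -/
def PreSUq.eval {B : Type*} [Ring B] [StarRing B] [Algebra ℂ B] [StarModule ℂ B]
    (u : Fin n → Fin n → B) : PreSUq q n →⋆ₐ[ℂ] B :=
  FreeStar.lift fun p : Fin n × Fin n => u p.1 p.2

variable (q n)

/-- The norms `‖u(x)‖` of an element of the free `*`-algebra in all families `u` of elements of
C⋆-algebras that satisfy the relations. -/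
def suqNorms (x : PreSUq q n) : Set ℝ :=
  {r | ∃ (B : Type) (_ : CStarAlgebra B) (u : Fin n → Fin n → B), SUqRelations q u ∧
    r = ‖PreSUq.eval (q := q) u x‖}

/-- The universal C⋆-seminorm on the free `*`-algebra. -/
def suqSeminorm (x : PreSUq q n) : ℝ := sSup (suqNorms q n x)

variable {q n}

theorem exists_norm_bound (x : FreeStar (Fin n × Fin n)) :
    ∃ C : ℝ, ∀ (B : Type) (_ : CStarAlgebra B) (u : Fin n → Fin n → B),
      SUqRelations q u → ‖FreeStar.lift (fun p : Fin n × Fin n => u p.1 p.2) x‖ ≤ C := by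
  induction x using freeStar_induction with
  | hc c =>
    refine ⟨‖c‖, fun B _ u _ => ?_⟩
    rw [AlgHomClass.commutes, Algebra.algebraMap_eq_smul_one]
    refine (norm_smul_le _ _).trans (mul_le_of_le_one_right (norm_nonneg _) ?_)
    rcases subsingleton_or_nontrivial B with _ | _
    · rw [Subsingleton.elim (1 : B) 0, norm_zero]; exact zero_le_one
    · rw [CStarRing.norm_one]
  | hι x =>
    refine ⟨1, fun B _ u hu => ?_⟩
    rw [FreeStar.lift_ι]
    rcases x with x | x
    · exact hu.norm_le_one _ _
    · exact (norm_star _).le.trans (hu.norm_le_one _ _)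
  | hm x y hx hy =>
    obtain ⟨C, hC⟩ := hx
    obtain ⟨D, hD⟩ := hy
    refine ⟨C * D, fun B _ u hu => ?_⟩
    rw [map_mul]
    exact (norm_mul_le _ _).trans (mul_le_mul (hC B _ u hu) (hD B _ u hu) (norm_nonneg _)
      ((norm_nonneg _).trans (hC B _ u hu)))
  | ha x y hx hy =>
    obtain ⟨C, hC⟩ := hx
    obtain ⟨D, hD⟩ := hy
    refine ⟨C + D, fun B _ u hu => ?_⟩
    rw [map_add]
    exact (norm_add_le _ _).trans (add_le_add (hC B _ u hu) (hD B _ u hu))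

theorem suqNorms_bddAbove (x : PreSUq q n) : BddAbove (suqNorms q n x) := by
  obtain ⟨C, hC⟩ := exists_norm_bound (q := q) (n := n) x
  exact ⟨C, by rintro r ⟨B, _, u, hu, rfl⟩; exact hC B _ u hu⟩

theorem norm_le_suqSeminorm {B : Type} [CStarAlgebra B] {u : Fin n → Fin n → B}
    (hu : SUqRelations q u) (x : PreSUq q n) :
    ‖PreSUq.eval (q := q) u x‖ ≤ suqSeminorm q n x :=
  le_csSup (suqNorms_bddAbove x) ⟨B, _, u, hu, rfl⟩

theorem suqSeminorm_nonneg (x : PreSUq q n) : 0 ≤ suqSeminorm q n x :=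
  Real.sSup_nonneg (by rintro r ⟨B, _, u, -, rfl⟩; exact norm_nonneg _)

theorem suqSeminorm_le {x : PreSUq q n} {C : ℝ} (hC : 0 ≤ C)
    (h : ∀ (B : Type) (_ : CStarAlgebra B) (u : Fin n → Fin n → B), SUqRelations q u →
      ‖PreSUq.eval (q := q) u x‖ ≤ C) : suqSeminorm q n x ≤ C :=
  Real.sSup_le (by rintro r ⟨B, _, u, hu, rfl⟩; exact h B _ u hu) hC

variable (q n)

/-- The universal seminorm as a ring seminorm. -/
def suqRingSeminorm : RingSeminorm (PreSUq q n) where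
  toFun := suqSeminorm q n
  map_zero' := le_antisymm
    (suqSeminorm_le le_rfl fun B _ u _ => by rw [map_zero, norm_zero]) (suqSeminorm_nonneg _)
  add_le' x y := suqSeminorm_le (add_nonneg (suqSeminorm_nonneg _) (suqSeminorm_nonneg _))
    fun B _ u hu => by
      rw [map_add]
      exact (norm_add_le _ _).trans
        (add_le_add (norm_le_suqSeminorm hu x) (norm_le_suqSeminorm hu y))
  neg' x := by
    refine le_antisymm ?_ ?_ <;> refine suqSeminorm_le (suqSeminorm_nonneg _) fun B _ u hu => ?_
    · rw [map_neg, norm_neg]; exact norm_le_suqSeminorm hu x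
    · refine le_trans (le_of_eq ?_) (norm_le_suqSeminorm hu (-x)); rw [map_neg, norm_neg]
  mul_le' x y := suqSeminorm_le (mul_nonneg (suqSeminorm_nonneg _) (suqSeminorm_nonneg _))
    fun B _ u hu => by
      rw [map_mul]
      exact (norm_mul_le _ _).trans (mul_le_mul (norm_le_suqSeminorm hu x)
        (norm_le_suqSeminorm hu y) (norm_nonneg _) (suqSeminorm_nonneg _))

instance : SeminormedRing (PreSUq q n) where
  __ := (suqRingSeminorm q n).toAddGroupSeminorm.toSeminormedAddCommGroup
  __ := (inferInstance : Ring (PreSUq q n))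
  norm_mul_le := (suqRingSeminorm q n).mul_le'

theorem norm_preSUq (x : PreSUq q n) : ‖x‖ = suqSeminorm q n x := rfl

instance : NormedAlgebra ℂ (PreSUq q n) where
  norm_smul_le c x := suqSeminorm_le (mul_nonneg (norm_nonneg _) (norm_nonneg _))
    fun B _ u hu => by
      rw [map_smul, norm_smul]
      exact mul_le_mul_of_nonneg_left (norm_le_suqSeminorm hu x) (norm_nonneg _)

theorem norm_star_preSUq (x : PreSUq q n) : ‖star x‖ ≤ ‖x‖ :=
  suqSeminorm_le (norm_nonneg _) fun B _ u hu => by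
    refine le_trans (le_of_eq ?_) (norm_le_suqSeminorm hu x)
    rw [← norm_star]
    exact congrArg _ ((map_star _ _).symm.trans (congrArg _ (star_star _)))

instance : NormedStarGroup (PreSUq q n) := ⟨norm_star_preSUq q n⟩

theorem norm_mul_self_preSUq (x : PreSUq q n) : ‖x‖ * ‖x‖ ≤ ‖star x * x‖ := by
  have : ‖x‖ ≤ √ ‖star x * x‖ := suqSeminorm_le (Real.sqrt_nonneg _) fun B _ u hu => by
    refine Real.le_sqrt_of_sq_le ?_
    rw [sq, ← CStarRing.norm_star_mul_self, ← map_star, ← map_mul]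
    exact norm_le_suqSeminorm hu _
  calc ‖x‖ * ‖x‖ ≤ √ ‖star x * x‖ * √ ‖star x * x‖ :=
        mul_le_mul this this (norm_nonneg _) (Real.sqrt_nonneg _)
    _ = _ := Real.mul_self_sqrt (norm_nonneg _)

instance : CStarRing (Completion (PreSUq q n)) where
  norm_mul_self_le x := Completion.induction_on x
    (isClosed_le (continuous_norm.mul continuous_norm)
      (continuous_norm.comp (continuous_star.mul continuous_id))) fun a => by
      rw [← coe_star, ← coe_mul, norm_coe, norm_coe]
      exact norm_mul_self_preSUq q n a

/-- The C⋆-algebra `C(SU_q(n))`: the universal C⋆-algebra given by the relations, constructed as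
the Hausdorff completion of the free `*`-algebra for the universal C⋆-seminorm. -/
def CSUq : Type := Completion (PreSUq q n)

instance : NormedRing (CSUq q n) := inferInstanceAs (NormedRing (Completion (PreSUq q n)))
instance : StarRing (CSUq q n) := inferInstanceAs (StarRing (Completion (PreSUq q n)))
instance : CompleteSpace (CSUq q n) := inferInstanceAs (CompleteSpace (Completion (PreSUq q n)))
instance : NormedAlgebra ℂ (CSUq q n) where
  __ := (inferInstanceAs (Algebra ℂ (Completion (PreSUq q n))) : Algebra ℂ (CSUq q n))
  norm_smul_le := norm_smul_le (α := ℂ) (β := Completion (PreSUq q n))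
instance : StarModule ℂ (CSUq q n) := inferInstanceAs (StarModule ℂ (Completion (PreSUq q n)))
instance : CStarRing (CSUq q n) := inferInstanceAs (CStarRing (Completion (PreSUq q n)))
instance : CStarAlgebra (CSUq q n) where

/-- The generators `u_{ij}` of `C(SU_q(n))`. -/
def CSUq.gen (i j : Fin n) : CSUq q n :=
  ((show PreSUq q n from FreeStar.gen (i, j)) : Completion (PreSUq q n))

end SUq

end

end SigmaCStar

open SigmaCStar

/-!
The algebraic tensor product carries the coarsest uniform structure for which all tensor products of
two continuous `*`-representations are continuous, so a map into its completion `A ⊗ A` is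
controlled by these representations, and a continuous homomorphism out of it by its values on
elementary tensors. Let `A` be the limit of a sequence with surjective connecting maps. A continuous
`*`-representation `π` of `A` kills the kernel of some `p_n`: otherwise there are `x_n` in the
kernel of `p_n` with `‖π x_n‖ = 1`, but these tend to zero. As `p_n` is surjective, `π` factors
through `A_n`. Hence the uniform structure of `A ⊗ A` is induced by the maps `p_n ⊗ p_n`, which
identify `A ⊗ A` with the limit of the `A_n ⊗ A_n`, and coassociativity and density may be checked
at each level.

For `SU_q(n)`, multiplying the determinant relation by `u_ij^*` shows that each `u_ij^*` is, up to a
power of `-q`, a quantum cofactor, hence a polynomial in the entries of `u`. Therefore the `u_ij`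
alone generate a dense subalgebra, and so do the `u_ij^*`, which reduces the density conditions to
`u_ij ⊗ 1 = ∑ₖ Δ(u_ik) (1 ⊗ u_jk^*)` and `1 ⊗ u_ij^* = ∑ₖ Δ(u_kj^*) (u_ki ⊗ 1)`.
-/

open scoped TensorProduct

namespace SigmaCStar

open UniformSpace (Completion)
open UniformSpace.Completion
open scoped CStarAlgebra

universe u v w

noncomputable section

section CompletionLift

variable {F : Type u} [Ring F] [UniformSpace F] [IsUniformAddGroup F] [StarRing F]
  [ContinuousStar F] [IsTopologicalRing F] [Algebra ℂ F] [UniformContinuousConstSMul ℂ F]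
  {C : Type v} [Ring C] [UniformSpace C] [IsUniformAddGroup C] [StarRing C] [ContinuousStar C]
  [IsTopologicalRing C] [Algebra ℂ C] [CompleteSpace C] [T0Space C]

/-- The extension of a continuous `*`-homomorphism to the Hausdorff completion of its domain. -/
def completionLift (h : F →⋆ₐ[ℂ] C) (hc : Continuous h) : Completion F →⋆ₐ[ℂ] C where
  __ := extensionHom (h : F →+* C) hc
  commutes' c := (extensionHom_coe (h : F →+* C) hc _).trans (AlgHomClass.commutes h c)
  map_star' x := by
    change Completion.extension h (star x) = star (Completion.extension h x)
    refine Completion.induction_on x (isClosed_eq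
      (continuous_extension.comp continuous_star) continuous_extension.star) fun a => ?_
    have hu : UniformContinuous h :=
      uniformContinuous_addMonoidHom_of_continuous (f := (h : F →+ C)) hc
    rw [← coe_star, extension_coe hu, extension_coe hu, map_star]

theorem completionLift_coe (h : F →⋆ₐ[ℂ] C) (hc : Continuous h) (x : F) :
    completionLift h hc (x : Completion F) = h x :=
  extensionHom_coe (h : F →+* C) hc x

theorem continuous_completionLift (h : F →⋆ₐ[ℂ] C) (hc : Continuous h) :
    Continuous (completionLift h hc) :=
  continuous_extension

end CompletionLift

namespace RepCompletion

variable {F : Type u} [Ring F] [StarRing F] [Algebra ℂ F] [StarModule ℂ F]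
  {ι : Type v} {H : ι → Type w} [∀ i, NormedAddCommGroup (H i)]
  [∀ i, InnerProductSpace ℂ (H i)] [∀ i, CompleteSpace (H i)]
  {f : ∀ i, F →⋆ₐ[ℂ] (H i →L[ℂ] H i)}

section Lift

variable {C : Type*} [Ring C] [UniformSpace C] [IsUniformAddGroup C] [StarRing C]
  [ContinuousStar C] [IsTopologicalRing C] [Algebra ℂ C] [CompleteSpace C] [T0Space C]
  (h : F →⋆ₐ[ℂ] C) (hc : Continuous fun x : WithReps f => h x)

/-- The extension to the completion of a `*`-homomorphism that is continuous for the topology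
defined by the representations `f i`. -/
def lift : RepCompletion f →⋆ₐ[ℂ] C :=
  completionLift (show WithReps f →⋆ₐ[ℂ] C from h) hc

theorem lift_of (x : F) : lift h hc (of f x) = h x :=
  completionLift_coe (show WithReps f →⋆ₐ[ℂ] C from h) hc x

theorem continuous_lift : Continuous (lift h hc) :=
  continuous_completionLift (show WithReps f →⋆ₐ[ℂ] C from h) hc

end Lift

theorem starAlgHom_ext {C : Type*} [Semiring C] [Star C] [Algebra ℂ C] [TopologicalSpace C]
    [T2Space C] {φ ψ : RepCompletion f →⋆ₐ[ℂ] C} (hφ : Continuous φ) (hψ : Continuous ψ)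
    (h : φ.comp (of f) = ψ.comp (of f)) : φ = ψ :=
  DFunLike.coe_injective <| (dense_range_of f).equalizer hφ hψ (congrArg DFunLike.coe h)

variable (f) in
/-- The extension of the representation `f i` to the completion. -/
def rep (i : ι) : RepCompletion f →⋆ₐ[ℂ] (H i →L[ℂ] H i) :=
  lift (f i) (continuous_evalRep f i)

theorem rep_of (i : ι) (x : F) : rep f i (of f x) = f i x := lift_of ..

theorem continuous_rep (i : ι) : Continuous (rep f i) := continuous_lift ..

omit [StarModule ℂ F] in
theorem isUniformInducing_evalRep :
    IsUniformInducing fun (x : WithReps f) i => evalRep f i x := by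
  refine isUniformInducing_iff_uniformSpace.2 ?_
  change UniformSpace.comap _ (Pi.uniformSpace _) = (⨅ i, UniformSpace.comap (evalRep f i) _)
  rw [Pi.uniformSpace_eq, UniformSpace.comap_iInf]
  exact iInf_congr fun i => (UniformSpace.comap_comap ..).symm

theorem isUniformInducing_rep : IsUniformInducing fun (x : RepCompletion f) i => rep f i x := by
  have hext : (fun (x : RepCompletion f) i => rep f i x) =
      Completion.extension fun (x : WithReps f) i => evalRep f i x :=
    (dense_range_of f).equalizer (continuous_pi continuous_rep) continuous_extension <|
      funext fun x => (funext fun i => rep_of i x).trans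
        (extension_coe isUniformInducing_evalRep.uniformContinuous _).symm
  rw [hext]
  exact Completion.isUniformInducing_extension isUniformInducing_evalRep

theorem isEmbedding_rep : Topology.IsEmbedding fun (x : RepCompletion f) i => rep f i x :=
  isUniformInducing_rep.isUniformEmbedding.isEmbedding

theorem ext_rep {x y : RepCompletion f} (h : ∀ i, rep f i x = rep f i y) : x = y :=
  isEmbedding_rep.injective (funext h)

theorem continuous_iff_rep {X : Type*} [TopologicalSpace X] {g : X → RepCompletion f} :
    Continuous g ↔ ∀ i, Continuous fun x => rep f i (g x) :=
  isEmbedding_rep.continuous_iff.trans continuous_pi_iff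

theorem continuous_of_cstarAlgebra {A : Type*} [CStarAlgebra A] (g : A →⋆ₐ[ℂ] RepCompletion f) :
    Continuous g :=
  continuous_iff_rep.2 fun i => map_continuous ((rep f i).comp g)

end RepCompletion

section HilbertAssoc

variable {H₁ H₂ H₃ : Type u} [NormedAddCommGroup H₁] [InnerProductSpace ℂ H₁]
  [NormedAddCommGroup H₂] [InnerProductSpace ℂ H₂]
  [NormedAddCommGroup H₃] [InnerProductSpace ℂ H₃]

theorem denseRange_mapIsometry {K₁ K₂ : Type u} [NormedAddCommGroup K₁] [InnerProductSpace ℂ K₁]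
    [NormedAddCommGroup K₂] [InnerProductSpace ℂ K₂] (f : H₁ →ₗᵢ[ℂ] K₁) (g : H₂ →ₗᵢ[ℂ] K₂)
    (hf : DenseRange f) (hg : DenseRange g) : DenseRange (TensorProduct.mapIsometry f g) := by
  let R : Submodule ℂ (K₁ ⊗[ℂ] K₂) :=
    (LinearMap.range (TensorProduct.mapIsometry f g).toLinearMap).topologicalClosure
  have hR : IsClosed (R : Set (K₁ ⊗[ℂ] K₂)) := Submodule.isClosed_topologicalClosure _
  have hcont : Continuous fun p : K₁ × K₂ => p.1 ⊗ₜ[ℂ] p.2 :=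
    (TensorProduct.mkL ℂ K₁ K₂).continuous₂
  have tmul_mem (p : K₁ × K₂) : p.1 ⊗ₜ[ℂ] p.2 ∈ R :=
    (hf.prodMap hg).induction_on (p := fun p => p.1 ⊗ₜ[ℂ] p.2 ∈ R) p (hR.preimage hcont)
      fun p => Submodule.le_topologicalClosure _ ⟨p.1 ⊗ₜ p.2, TensorProduct.map_tmul ..⟩
  intro x
  change x ∈ R
  induction x using TensorProduct.induction_on with
  | zero => exact R.zero_mem
  | add x y hx hy => exact R.add_mem hx hy
  | tmul a b => exact tmul_mem (a, b)

variable (H₁ H₂ H₃) in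
/-- The inclusion of the algebraic tensor product `(H₁ ⊗ H₂) ⊗ H₃` into its completion, which is
taken in two steps. -/
def hilbertTensorLeft : (H₁ ⊗[ℂ] H₂) ⊗[ℂ] H₃ →ₗᵢ[ℂ] HilbertTensor (HilbertTensor H₁ H₂) H₃ :=
  toComplₗᵢ.comp (TensorProduct.mapIsometry toComplₗᵢ LinearIsometry.id)

variable (H₁ H₂ H₃) in
/-- The inclusion of the algebraic tensor product `H₁ ⊗ (H₂ ⊗ H₃)` into its completion, which is
taken in two steps. -/
def hilbertTensorRight : H₁ ⊗[ℂ] (H₂ ⊗[ℂ] H₃) →ₗᵢ[ℂ] HilbertTensor H₁ (HilbertTensor H₂ H₃) :=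
  toComplₗᵢ.comp (TensorProduct.mapIsometry LinearIsometry.id toComplₗᵢ)

theorem denseRange_hilbertTensorLeft : DenseRange (hilbertTensorLeft H₁ H₂ H₃) :=
  (denseRange_coe (α := HilbertTensor H₁ H₂ ⊗[ℂ] H₃)).comp
    (denseRange_mapIsometry _ _ denseRange_coe Function.surjective_id.denseRange)
    (continuous_coe _)

theorem denseRange_hilbertTensorRight : DenseRange (hilbertTensorRight H₁ H₂ H₃) :=
  (denseRange_coe (α := H₁ ⊗[ℂ] HilbertTensor H₂ H₃)).comp
    (denseRange_mapIsometry _ _ Function.surjective_id.denseRange denseRange_coe)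
    (continuous_coe _)

theorem norm_hilbertTensorRight_assoc (x : (H₁ ⊗[ℂ] H₂) ⊗[ℂ] H₃) :
    ‖(hilbertTensorRight H₁ H₂ H₃).toLinearMap (TensorProduct.assoc ℂ H₁ H₂ H₃ x)‖ =
      ‖(hilbertTensorLeft H₁ H₂ H₃).toLinearMap x‖ :=
  ((hilbertTensorRight H₁ H₂ H₃).norm_map _).trans <|
    ((TensorProduct.assocIsometry ℂ H₁ H₂ H₃).norm_map x).trans
      ((hilbertTensorLeft H₁ H₂ H₃).norm_map x).symm

variable (H₁ H₂ H₃) in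
/-- The associativity isomorphism of the Hilbert space tensor product. -/
def hilbertAssoc :
    HilbertTensor (HilbertTensor H₁ H₂) H₃ ≃ₗᵢ[ℂ] HilbertTensor H₁ (HilbertTensor H₂ H₃) :=
  (TensorProduct.assoc ℂ H₁ H₂ H₃).extendOfIsometry
    (hilbertTensorLeft H₁ H₂ H₃).toLinearMap (hilbertTensorRight H₁ H₂ H₃).toLinearMap
    denseRange_hilbertTensorLeft denseRange_hilbertTensorRight norm_hilbertTensorRight_assoc

theorem hilbertAssoc_hilbertTensorLeft (x : (H₁ ⊗[ℂ] H₂) ⊗[ℂ] H₃) :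
    hilbertAssoc H₁ H₂ H₃ (hilbertTensorLeft H₁ H₂ H₃ x) =
      hilbertTensorRight H₁ H₂ H₃ (TensorProduct.assoc ℂ H₁ H₂ H₃ x) :=
  LinearEquiv.extendOfIsometry_eq _ _ _ denseRange_hilbertTensorLeft
    denseRange_hilbertTensorRight norm_hilbertTensorRight_assoc x

variable [CompleteSpace H₁] [CompleteSpace H₂] [CompleteSpace H₃]

theorem opTensor_hilbertTensorLeft (S : H₁ →L[ℂ] H₁) (T : H₂ →L[ℂ] H₂) (R : H₃ →L[ℂ] H₃)
    (a : H₁) (b : H₂) (c : H₃) :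
    opTensor (opTensor S T) R (hilbertTensorLeft H₁ H₂ H₃ ((a ⊗ₜ b) ⊗ₜ c)) =
      hilbertTensorLeft H₁ H₂ H₃ ((S a ⊗ₜ T b) ⊗ₜ R c) := by
  refine (opTensor_coe (opTensor S T) R
    (((a ⊗ₜ[ℂ] b : H₁ ⊗[ℂ] H₂) : HilbertTensor H₁ H₂) ⊗ₜ[ℂ] c)).trans ?_
  refine congrArg _ ((TensorProduct.map_tmul _ _ _ _).trans ?_)
  exact congrArg (· ⊗ₜ[ℂ] R c) (opTensor_coe S T (a ⊗ₜ b))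

theorem opTensor_hilbertTensorRight (S : H₁ →L[ℂ] H₁) (T : H₂ →L[ℂ] H₂) (R : H₃ →L[ℂ] H₃)
    (a : H₁) (b : H₂) (c : H₃) :
    opTensor S (opTensor T R) (hilbertTensorRight H₁ H₂ H₃ (a ⊗ₜ (b ⊗ₜ c))) =
      hilbertTensorRight H₁ H₂ H₃ (S a ⊗ₜ (T b ⊗ₜ R c)) := by
  refine (opTensor_coe S (opTensor T R)
    (a ⊗ₜ[ℂ] ((b ⊗ₜ[ℂ] c : H₂ ⊗[ℂ] H₃) : HilbertTensor H₂ H₃))).trans ?_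
  refine congrArg _ ((TensorProduct.map_tmul _ _ _ _).trans ?_)
  exact congrArg (S a ⊗ₜ[ℂ] ·) (opTensor_coe T R (b ⊗ₜ c))

theorem hilbertAssoc_opTensor (S : H₁ →L[ℂ] H₁) (T : H₂ →L[ℂ] H₂) (R : H₃ →L[ℂ] H₃)
    (ξ : HilbertTensor (HilbertTensor H₁ H₂) H₃) :
    hilbertAssoc H₁ H₂ H₃ (opTensor (opTensor S T) R ξ) =
      opTensor S (opTensor T R) (hilbertAssoc H₁ H₂ H₃ ξ) := by
  refine denseRange_hilbertTensorLeft.induction_on (p := fun ξ => hilbertAssoc H₁ H₂ H₃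
    (opTensor (opTensor S T) R ξ) = opTensor S (opTensor T R) (hilbertAssoc H₁ H₂ H₃ ξ)) ξ
    (isClosed_eq (by fun_prop) (by fun_prop)) fun x => ?_
  let α := (hilbertAssoc H₁ H₂ H₃).toLinearEquiv.toLinearMap
  let j := (hilbertTensorLeft H₁ H₂ H₃).toLinearMap
  suffices α ∘ₗ (opTensor (opTensor S T) R).toLinearMap ∘ₗ j =
      (opTensor S (opTensor T R)).toLinearMap ∘ₗ α ∘ₗ j from LinearMap.congr_fun this x
  refine TensorProduct.ext_threefold fun a b c => ?_
  change hilbertAssoc H₁ H₂ H₃ (opTensor (opTensor S T) R (hilbertTensorLeft H₁ H₂ H₃ _)) =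
    opTensor S (opTensor T R) (hilbertAssoc H₁ H₂ H₃ (hilbertTensorLeft H₁ H₂ H₃ _))
  rw [opTensor_hilbertTensorLeft, hilbertAssoc_hilbertTensorLeft, hilbertAssoc_hilbertTensorLeft,
    TensorProduct.assoc_tmul, TensorProduct.assoc_tmul, opTensor_hilbertTensorRight]

variable (H₁ H₂ H₃) in
/-- Conjugation of operators by the associativity isomorphism. It compares the representations
`(π ⊗ ρ) ⊗ σ` and `π ⊗ (ρ ⊗ σ)`. -/
def assocConj : (HilbertTensor (HilbertTensor H₁ H₂) H₃ →L[ℂ]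
      HilbertTensor (HilbertTensor H₁ H₂) H₃) →⋆ₐ[ℂ]
    (HilbertTensor H₁ (HilbertTensor H₂ H₃) →L[ℂ] HilbertTensor H₁ (HilbertTensor H₂ H₃)) :=
  (hilbertAssoc H₁ H₂ H₃).conjStarAlgEquiv.toStarAlgHom

theorem assocConj_opTensor (S : H₁ →L[ℂ] H₁) (T : H₂ →L[ℂ] H₂) (R : H₃ →L[ℂ] H₃) :
    assocConj H₁ H₂ H₃ (opTensor (opTensor S T) R) = opTensor S (opTensor T R) := by
  refine ContinuousLinearMap.ext fun η => ?_
  obtain ⟨ξ, rfl⟩ := (hilbertAssoc H₁ H₂ H₃).surjective η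
  rw [← hilbertAssoc_opTensor]
  exact congrArg (fun ζ => hilbertAssoc H₁ H₂ H₃ (opTensor (opTensor S T) R ζ))
    ((hilbertAssoc H₁ H₂ H₃).symm_apply_apply ξ)

omit [CompleteSpace H₁] [CompleteSpace H₂] [CompleteSpace H₃] in
theorem isometry_assocConj : Isometry (assocConj H₁ H₂ H₃) :=
  NonUnitalStarAlgHom.isometry (assocConj H₁ H₂ H₃)
    (hilbertAssoc H₁ H₂ H₃).conjStarAlgEquiv.injective

end HilbertAssoc

section MinTensor

variable {A B C D : Type u}
  [Ring A] [StarRing A] [Algebra ℂ A] [StarModule ℂ A]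
  [Ring B] [StarRing B] [Algebra ℂ B] [StarModule ℂ B]

theorem tensorStarAlgHom_ext {E : Type*} [Semiring E] [Star E] [Algebra ℂ E]
    {φ ψ : A ⊗[ℂ] B →⋆ₐ[ℂ] E} (h : ∀ a b, φ (a ⊗ₜ b) = ψ (a ⊗ₜ b)) : φ = ψ :=
  StarAlgHom.ext <| AlgHom.congr_fun <|
    Algebra.TensorProduct.ext' (g := φ.toAlgHom) (h := ψ.toAlgHom) h

variable [TopologicalSpace A] [TopologicalSpace B]
  [Ring C] [StarRing C] [Algebra ℂ C] [StarModule ℂ C] [TopologicalSpace C]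
  [Ring D] [StarRing D] [Algebra ℂ D] [StarModule ℂ D] [TopologicalSpace D]

theorem MinTensor.hom_ext {E : Type*} [Semiring E] [Star E] [Algebra ℂ E] [TopologicalSpace E]
    [T2Space E] {φ ψ : MinTensor A B →⋆ₐ[ℂ] E} (hφ : Continuous φ) (hψ : Continuous ψ)
    (h : ∀ a b, φ (tmul a b) = ψ (tmul a b)) : φ = ψ :=
  RepCompletion.starAlgHom_ext hφ hψ (tensorStarAlgHom_ext h)

theorem MinTensor.continuous_map (f : A →⋆ₐ[ℂ] C) (hf : Continuous f) (g : B →⋆ₐ[ℂ] D)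
    (hg : Continuous g) : Continuous (MinTensor.map f hf g hg) :=
  RepCompletion.continuous_map ..

theorem continuous_leg₁₂ : Continuous (leg₁₂ A B C) := RepCompletion.continuous_map ..

theorem continuous_leg₂₃ : Continuous (leg₂₃ A B C) := RepCompletion.continuous_map ..

namespace Rep

omit [StarModule ℂ A] [StarModule ℂ B] in
/-- The representation `r ∘ f`. -/
abbrev comp (r : Rep B) (f : A →⋆ₐ[ℂ] B) (hf : Continuous f) : Rep A :=
  ⟨r.H, r.π.comp f, r.continuous_π.comp hf⟩

variable (r : Rep A) (s : Rep B) (t : Rep C)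

/-- The representation `r ⊗ s` of `A ⊗ B`. -/
def tensor : MinTensor A B →⋆ₐ[ℂ] (HilbertTensor r.H s.H →L[ℂ] HilbertTensor r.H s.H) :=
  RepCompletion.rep (pairRep A B) (r, s)

/-- The representation `(r ⊗ s) ⊗ t` of `A ⊗ B ⊗ C`. -/
def tensor₃ : MinTensor₃ A B C →⋆ₐ[ℂ] (HilbertTensor (HilbertTensor r.H s.H) t.H →L[ℂ]
    HilbertTensor (HilbertTensor r.H s.H) t.H) :=
  RepCompletion.rep (tripleRep A B C) (r, s, t)

theorem continuous_tensor : Continuous (r.tensor s) := RepCompletion.continuous_rep _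

theorem continuous_tensor₃ : Continuous (r.tensor₃ s t) := RepCompletion.continuous_rep _

theorem tensor_of (x : A ⊗[ℂ] B) :
    r.tensor s (RepCompletion.of _ x) = tensorRep r.π s.π x :=
  RepCompletion.rep_of ..

theorem tensor_tmul (a : A) (b : B) : r.tensor s (tmul a b) = opTensor (r.π a) (s.π b) :=
  (tensor_of ..).trans (tensorRep_tmul ..)

theorem tensor₃_of_tmul (x : A ⊗[ℂ] B) (c : C) :
    r.tensor₃ s t (RepCompletion.of _ (x ⊗ₜ c)) = opTensor (tensorRep r.π s.π x) (t.π c) :=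
  (RepCompletion.rep_of _ _).trans (tensorRep_tmul ..)

theorem tensor₃_leg₁₂ (x : MinTensor A B) :
    r.tensor₃ s t (leg₁₂ A B C x) = opTensor (r.tensor s x) 1 := by
  let amp := ampLeft (HilbertTensor r.H s.H) t.H
  have hamp : Continuous amp := continuous_ampLeft ..
  suffices (r.tensor₃ s t).comp (leg₁₂ A B C) = amp.comp (r.tensor s) from
    DFunLike.congr_fun this x
  refine MinTensor.hom_ext ((continuous_tensor₃ r s t).comp continuous_leg₁₂)
    (hamp.comp (continuous_tensor r s)) fun a b => ?_
  refine (congrArg (r.tensor₃ s t) (leg₁₂_of (a ⊗ₜ b))).trans <|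
    (tensor₃_of_tmul r s t (a ⊗ₜ b) 1).trans ?_
  rw [map_one, ← tensor_of]
  rfl

theorem tensor₃_leg₃ (c : C) : r.tensor₃ s t (leg₃ A B C c) = opTensor 1 (t.π c) :=
  (tensor₃_of_tmul r s t 1 c).trans (by rw [map_one])

theorem assocConj_tensor₃_leg₁ (a : A) :
    assocConj r.H s.H t.H (r.tensor₃ s t (leg₁ A B C a)) = opTensor (r.π a) 1 := by
  refine (congrArg _ (tensor₃_of_tmul r s t (a ⊗ₜ 1) 1)).trans ?_
  rw [tensorRep_tmul, map_one, map_one, assocConj_opTensor, opTensor_one]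

theorem assocConj_tensor₃_leg₂₃ (x : MinTensor B C) :
    assocConj r.H s.H t.H (r.tensor₃ s t (leg₂₃ A B C x)) = opTensor 1 (s.tensor t x) := by
  let conj := assocConj r.H s.H t.H
  let amp := ampRight r.H (HilbertTensor s.H t.H)
  have hamp : Continuous amp := continuous_ampRight ..
  have hconj : Continuous conj := isometry_assocConj.continuous
  suffices (conj.comp (r.tensor₃ s t)).comp (leg₂₃ A B C) = amp.comp (s.tensor t) from
    DFunLike.congr_fun this x
  refine MinTensor.hom_ext (hconj.comp ((continuous_tensor₃ r s t).comp continuous_leg₂₃))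
    (hamp.comp (continuous_tensor s t)) fun b c => ?_
  refine (congrArg (fun z => conj (r.tensor₃ s t z))
    ((leg₂₃_of (b ⊗ₜ c)).trans (congrArg _ (algMap_tmul ..)))).trans <|
    (congrArg conj (tensor₃_of_tmul r s t (1 ⊗ₜ b) c)).trans ?_
  rw [tensorRep_tmul, map_one]
  exact (assocConj_opTensor ..).trans (congrArg (opTensor 1) (tensor_tmul s t b c).symm)

omit t in
theorem tensor_map (f : C →⋆ₐ[ℂ] A) (hf : Continuous f) (g : D →⋆ₐ[ℂ] B) (hg : Continuous g)
    (x : MinTensor C D) :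
    r.tensor s (MinTensor.map f hf g hg x) = (r.comp f hf).tensor (s.comp g hg) x := by
  suffices (r.tensor s).comp (MinTensor.map f hf g hg) = (r.comp f hf).tensor (s.comp g hg) from
    DFunLike.congr_fun this x
  refine MinTensor.hom_ext
    ((continuous_tensor r s).comp (MinTensor.continuous_map f hf g hg))
    (continuous_tensor _ _) fun c d => ?_
  exact (congrArg (r.tensor s) (MinTensor.map_tmul f hf g hg c d)).trans <|
    (tensor_tmul ..).trans (tensor_tmul (r.comp f hf) (s.comp g hg) c d).symm

end Rep

end MinTensor

section Comultiplication

variable {A : Type u} [Ring A] [StarRing A] [Algebra ℂ A] [StarModule ℂ A] [TopologicalSpace A]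
  (Δ : A →⋆ₐ[ℂ] MinTensor A A) (hΔ : Continuous Δ)

theorem comulIdAlg_tmul (a b : A) : comulIdAlg Δ (a ⊗ₜ b) = leg₁₂ A A A (Δ a) * leg₃ A A A b :=
  liftCommute_tmul ..

theorem idComulAlg_tmul (a b : A) : idComulAlg Δ (a ⊗ₜ b) = leg₁ A A A a * leg₂₃ A A A (Δ b) :=
  liftCommute_tmul ..

namespace Rep

/-- The convolution `(r ⊗ s)Δ` of two representations. -/
abbrev convolve (r s : Rep A) : Rep A :=
  ⟨HilbertTensor r.H s.H, (r.tensor s).comp Δ, (continuous_tensor r s).comp hΔ⟩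

variable (r s t : Rep A)

theorem tensor₃_comulIdAlg (x : A ⊗[ℂ] A) :
    r.tensor₃ s t (comulIdAlg Δ x) = tensorRep ((r.tensor s).comp Δ) t.π x := by
  suffices (r.tensor₃ s t).comp (comulIdAlg Δ) = tensorRep ((r.tensor s).comp Δ) t.π from
    DFunLike.congr_fun this x
  refine tensorStarAlgHom_ext fun a b => ?_
  refine (congrArg (r.tensor₃ s t) (comulIdAlg_tmul Δ a b)).trans ((map_mul ..).trans ?_)
  rw [tensor₃_leg₁₂, tensor₃_leg₃, ← opTensor_mul, mul_one, one_mul, tensorRep_tmul]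
  rfl

theorem assocConj_tensor₃_idComulAlg (x : A ⊗[ℂ] A) :
    assocConj r.H s.H t.H (r.tensor₃ s t (idComulAlg Δ x)) =
      tensorRep r.π ((s.tensor t).comp Δ) x := by
  let conj := assocConj r.H s.H t.H
  suffices (conj.comp (r.tensor₃ s t)).comp (idComulAlg Δ) =
      tensorRep r.π ((s.tensor t).comp Δ) from DFunLike.congr_fun this x
  refine tensorStarAlgHom_ext fun a b => ?_
  refine (congrArg (conj.comp (r.tensor₃ s t)) (idComulAlg_tmul Δ a b)).trans <|
    (map_mul ..).trans <|
      (congrArg₂ (· * ·) (assocConj_tensor₃_leg₁ ..) (assocConj_tensor₃_leg₂₃ ..)).trans ?_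
  rw [← opTensor_mul, mul_one, one_mul, tensorRep_tmul]
  rfl

end Rep

include hΔ in
theorem continuous_comulIdAlg :
    Continuous fun x : WithReps (pairRep A A) => comulIdAlg Δ x :=
  RepCompletion.continuous_iff_rep.2 fun ⟨r, s, t⟩ =>
    (continuous_tensorRep _ (r.convolve Δ hΔ s).continuous_π _ t.continuous_π).congr
      fun x => (Rep.tensor₃_comulIdAlg Δ r s t x).symm

include hΔ in
theorem continuous_idComulAlg :
    Continuous fun x : WithReps (pairRep A A) => idComulAlg Δ x :=
  RepCompletion.continuous_iff_rep.2 fun ⟨r, s, t⟩ =>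
    (isometry_assocConj (H₁ := r.H) (H₂ := s.H) (H₃ := t.H)).isUniformInducing.isInducing
      |>.continuous_iff.2 <|
      (continuous_tensorRep _ r.continuous_π _ (s.convolve Δ hΔ t).continuous_π).congr
        fun x => (Rep.assocConj_tensor₃_idComulAlg Δ r s t x).symm

/-- The map `comulId Δ` as a `*`-homomorphism, for continuous `Δ`. -/
def comulIdHom : MinTensor A A →⋆ₐ[ℂ] MinTensor₃ A A A :=
  RepCompletion.lift (comulIdAlg Δ) (continuous_comulIdAlg Δ hΔ)

/-- The map `idComul Δ` as a `*`-homomorphism, for continuous `Δ`. -/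
def idComulHom : MinTensor A A →⋆ₐ[ℂ] MinTensor₃ A A A :=
  RepCompletion.lift (idComulAlg Δ) (continuous_idComulAlg Δ hΔ)

theorem continuous_comulIdHom : Continuous (comulIdHom Δ hΔ) := RepCompletion.continuous_lift ..

theorem continuous_idComulHom : Continuous (idComulHom Δ hΔ) := RepCompletion.continuous_lift ..

theorem comulIdHom_of (x : A ⊗[ℂ] A) :
    comulIdHom Δ hΔ (RepCompletion.of _ x) = comulIdAlg Δ x :=
  RepCompletion.lift_of ..

theorem idComulHom_of (x : A ⊗[ℂ] A) :
    idComulHom Δ hΔ (RepCompletion.of _ x) = idComulAlg Δ x :=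
  RepCompletion.lift_of ..

theorem comulIdHom_tmul (a b : A) :
    comulIdHom Δ hΔ (tmul a b) = leg₁₂ A A A (Δ a) * leg₃ A A A b :=
  (comulIdHom_of ..).trans (comulIdAlg_tmul Δ a b)

theorem idComulHom_tmul (a b : A) :
    idComulHom Δ hΔ (tmul a b) = leg₁ A A A a * leg₂₃ A A A (Δ b) :=
  (idComulHom_of ..).trans (idComulAlg_tmul Δ a b)

namespace Rep

variable (r s t : Rep A)

theorem tensor₃_comulIdHom (x : MinTensor A A) :
    r.tensor₃ s t (comulIdHom Δ hΔ x) = (r.convolve Δ hΔ s).tensor t x := by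
  suffices (r.tensor₃ s t).comp (comulIdHom Δ hΔ) = (r.convolve Δ hΔ s).tensor t from
    DFunLike.congr_fun this x
  refine RepCompletion.starAlgHom_ext
    ((continuous_tensor₃ r s t).comp (continuous_comulIdHom Δ hΔ))
    (continuous_tensor _ _) (StarAlgHom.ext fun y => ?_)
  exact (congrArg (r.tensor₃ s t) (comulIdHom_of Δ hΔ y)).trans <|
    (tensor₃_comulIdAlg Δ r s t y).trans (tensor_of (r.convolve Δ hΔ s) t y).symm

theorem assocConj_tensor₃_idComulHom (x : MinTensor A A) :
    assocConj r.H s.H t.H (r.tensor₃ s t (idComulHom Δ hΔ x)) =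
      r.tensor (s.convolve Δ hΔ t) x := by
  let conj := assocConj r.H s.H t.H
  have hconj : Continuous conj := isometry_assocConj.continuous
  suffices (conj.comp (r.tensor₃ s t)).comp (idComulHom Δ hΔ) = r.tensor (s.convolve Δ hΔ t) from
    DFunLike.congr_fun this x
  refine RepCompletion.starAlgHom_ext
    (hconj.comp ((continuous_tensor₃ r s t).comp (continuous_idComulHom Δ hΔ)))
    (continuous_tensor _ _) (StarAlgHom.ext fun y => ?_)
  exact (congrArg (fun z => conj (r.tensor₃ s t z)) (idComulHom_of Δ hΔ y)).trans <|
    (assocConj_tensor₃_idComulAlg Δ r s t y).trans (tensor_of r (s.convolve Δ hΔ t) y).symm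

end Rep

theorem coassociative_iff_convolve_assoc :
    (∀ a, comulId Δ (Δ a) = idComul Δ (Δ a)) ↔ ∀ (r s t : Rep A) (a : A),
      assocConj r.H s.H t.H (((r.convolve Δ hΔ s).convolve Δ hΔ t).π a) =
        (r.convolve Δ hΔ (s.convolve Δ hΔ t)).π a := by
  have left_apply (r s t : Rep A) (a : A) :
      r.tensor₃ s t (comulId Δ (Δ a)) = ((r.convolve Δ hΔ s).convolve Δ hΔ t).π a :=
    Rep.tensor₃_comulIdHom Δ hΔ r s t (Δ a)
  have right_apply (r s t : Rep A) (a : A) :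
      assocConj r.H s.H t.H (r.tensor₃ s t (idComul Δ (Δ a))) =
        (r.convolve Δ hΔ (s.convolve Δ hΔ t)).π a :=
    Rep.assocConj_tensor₃_idComulHom Δ hΔ r s t (Δ a)
  refine ⟨fun h r s t a => ?_, fun h a => RepCompletion.ext_rep fun ⟨r, s, t⟩ => ?_⟩
  · exact (congrArg _ (left_apply r s t a)).symm.trans <|
      (congrArg (fun z => assocConj r.H s.H t.H (r.tensor₃ s t z)) (h a)).trans
        (right_apply r s t a)
  · refine (isometry_assocConj (H₁ := r.H) (H₂ := s.H) (H₃ := t.H)).injective ?_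
    exact (congrArg _ (left_apply r s t a)).trans <|
      (h r s t a).trans (right_apply r s t a).symm

end Comultiplication

section Coherent

variable {X : ℕ → Type*} (f : ∀ n, X (n + 1) → X n)

/-- The coherent sequences of an inverse sequence, that is, the points of its limit. -/
def IsCoherent (y : ∀ n, X n) : Prop := ∀ n, f n (y (n + 1)) = y n

theorem exists_isCoherent_apply_eq (n : ℕ) : ∀ {X : ℕ → Type*} (f : ∀ k, X (k + 1) → X k),
    (∀ k, Function.Surjective (f k)) → ∀ a : X n, ∃ y, IsCoherent f y ∧ y n = a := by
  induction n with
  | zero =>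
    intro X f hf a
    exact ⟨fun k => Nat.rec a (fun k y => Function.surjInv (hf k) y) k,
      fun k => Function.surjInv_eq (hf k) _, rfl⟩
  | succ n ih =>
    intro X f hf a
    obtain ⟨y, hy, rfl⟩ := ih (X := fun k => X (k + 1)) (fun k => f (k + 1)) (fun k => hf _) a
    refine ⟨fun k => Nat.casesOn k (f 0 (y 0)) y, fun k => ?_, rfl⟩
    cases k with
    | zero => rfl
    | succ k => exact hy k

variable {f}

section TopologicalSpace

variable [∀ n, TopologicalSpace (X n)] (hf : ∀ n, Continuous (f n))
include hf

theorem exists_continuous_forall_isCoherent {i N : ℕ} (h : i ≤ N) :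
    ∃ g : X N → X i, Continuous g ∧ ∀ y, IsCoherent f y → g (y N) = y i := by
  induction N, h using Nat.le_induction with
  | base => exact ⟨id, continuous_id, fun _ _ => rfl⟩
  | succ N _ ih =>
    obtain ⟨g, hg, hgy⟩ := ih
    exact ⟨g ∘ f N, hg.comp (hf N), fun y hy => (congrArg g (hy N)).trans (hgy y hy)⟩

theorem IsCoherent.exists_isOpen_apply {y : ∀ n, X n} (hy : IsCoherent f y)
    {V : Set (∀ n, X n)} (hV : IsOpen V) (hyV : y ∈ V) :
    ∃ N, ∃ W : Set (X N), IsOpen W ∧ y N ∈ W ∧ ∀ z, IsCoherent f z → z N ∈ W → z ∈ V := by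
  obtain ⟨I, u, hu, hIV⟩ := isOpen_pi_iff.1 hV y hyV
  choose g hg hgy using fun i : I =>
    exists_continuous_forall_isCoherent hf (Finset.le_sup (f := id) i.2)
  refine ⟨I.sup id, ⋂ i : I, g i ⁻¹' u i, isOpen_iInter_of_finite fun i =>
    (hu i i.2).1.preimage (hg i), Set.mem_iInter.2 fun i => ?_, fun z hz hzW => hIV fun i hi => ?_⟩
  · rw [Set.mem_preimage, hgy i y hy]
    exact (hu i i.2).2
  · have hgz := Set.mem_iInter.1 hzW ⟨i, hi⟩
    rwa [Set.mem_preimage, hgy ⟨i, hi⟩ z hz] at hgz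

theorem dense_of_forall_dense_image_apply {Z : Type*} [TopologicalSpace Z] {p : Z → ∀ n, X n}
    (hp : Topology.IsInducing p) (hc : ∀ z, IsCoherent f (p z)) {S : Set Z}
    (hS : ∀ n, Dense ((fun z => p z n) '' S)) : Dense S := by
  refine dense_iff_inter_open.2 fun U hU ⟨z, hz⟩ => ?_
  obtain ⟨V, hV, rfl⟩ := hp.isOpen_iff.1 hU
  obtain ⟨N, W, hW, hzW, hWV⟩ := (hc z).exists_isOpen_apply hf hV hz
  obtain ⟨_, hs, s, hsS, rfl⟩ := (hS N).inter_open_nonempty W hW ⟨_, hzW⟩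
  exact ⟨s, hWV _ (hc s) hs, hsS⟩

end TopologicalSpace

theorem range_eq_setOf_isCoherent [∀ n, UniformSpace (X n)] [∀ n, T2Space (X n)]
    (hf : ∀ n, Continuous (f n)) {Z : Type*} [UniformSpace Z] [CompleteSpace Z]
    {p : Z → ∀ n, X n} (hp : IsUniformInducing p) (hc : ∀ z, IsCoherent f (p z))
    (hd : ∀ n, DenseRange fun z => p z n) : Set.range p = {y | IsCoherent f y} := by
  refine (Set.range_subset_iff.2 hc).antisymm fun y hy => ?_
  rw [← hp.isComplete_range.isClosed.closure_eq]
  refine mem_closure_iff.2 fun V hV hyV => ?_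
  obtain ⟨N, W, hW, hyW, h⟩ := IsCoherent.exists_isOpen_apply hf hy hV hyV
  obtain ⟨z, hz⟩ := (hd N).exists_mem_open hW ⟨_, hyW⟩
  exact ⟨p z, h _ (hc z) hz, z, rfl⟩

theorem isUniformInducing_of_factor {Z I J : Type*} [UniformSpace Z] {R : I → Type*}
    [∀ i, UniformSpace (R i)] {T : J → Type*} [∀ j, UniformSpace (T j)] {r : Z → ∀ i, R i}
    (hr : IsUniformInducing r) {t : Z → ∀ j, T j} (ht : ∀ j, UniformContinuous fun z => t z j)
    (h : ∀ i, ∃ j, ∃ g : T j → R i, UniformContinuous g ∧ ∀ z, r z i = g (t z j)) :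
    IsUniformInducing t := by
  refine isUniformInducing_iff_uniformSpace.2 (le_antisymm ?_
    (uniformContinuous_iff_le_comap.1 (uniformContinuous_pi.2 ht)))
  refine le_of_le_of_eq ?_ (isUniformInducing_iff_uniformSpace.1 hr)
  conv_rhs => rw [Pi.uniformSpace_eq, UniformSpace.comap_iInf]
  refine le_iInf fun i => ?_
  rw [← UniformSpace.comap_comap]
  obtain ⟨j, g, hg, h⟩ := h i
  refine (UniformSpace.comap_mono (uniformContinuous_iff_le_comap.1
    (hg.comp (Pi.uniformContinuous_proj _ j)))).trans (le_of_eq ?_)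
  exact UniformSpace.comap_comap.symm.trans
    (congrArg (UniformSpace.comap · _) (funext fun z => (h z).symm))

end Coherent

section StarAlgHom

variable {A B C : Type*} [Ring A] [StarRing A] [Algebra ℂ A] [Ring B] [StarRing B] [Algebra ℂ B]
  [Ring C] [StarRing C] [Algebra ℂ C]

theorem exists_starAlgHom_comp_eq (p : A →⋆ₐ[ℂ] B) (hp : Function.Surjective p)
    (φ : A →⋆ₐ[ℂ] C) (h : ∀ x, p x = 0 → φ x = 0) : ∃ ψ : B →⋆ₐ[ℂ] C, φ = ψ.comp p := by
  let ψ : B →+* C := (p : A →+* B).liftOfSurjective hp ⟨(φ : A →+* C), h⟩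
  have hψ (a : A) : ψ (p a) = φ a :=
    RingHom.liftOfRightInverse_comp_apply (p : A →+* B) _ _ ⟨(φ : A →+* C), h⟩ a
  refine ⟨{ ψ with
    commutes' := fun c => ?_
    map_star' := fun b => ?_ }, StarAlgHom.ext fun a => (hψ a).symm⟩
  · change ψ (algebraMap ℂ B c) = _
    rw [← AlgHomClass.commutes p, hψ, AlgHomClass.commutes]
  · obtain ⟨a, rfl⟩ := hp b
    change ψ (star (p a)) = star (ψ (p a))
    rw [← map_star, hψ, hψ, map_star]

theorem exists_starAlgHom_lift {J : Type*} {T : J → Type*} [∀ j, Ring (T j)]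
    [∀ j, StarRing (T j)] [∀ j, Algebra ℂ (T j)] (t : ∀ j, B →⋆ₐ[ℂ] T j)
    (ht : Function.Injective fun b j => t j b) (g : ∀ j, A →⋆ₐ[ℂ] T j)
    (h : ∀ a, ∃ b, ∀ j, t j b = g j a) : ∃ φ : A →⋆ₐ[ℂ] B, ∀ j a, t j (φ a) = g j a := by
  choose φ hφ using h
  have ext {x y : B} (hxy : ∀ j, t j x = t j y) : x = y := ht (funext hxy)
  exact ⟨{
    toFun := φ
    map_one' := ext fun j => by rw [hφ, map_one, map_one]
    map_zero' := ext fun j => by rw [hφ, map_zero, map_zero]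
    map_mul' := fun a b => ext fun j => by rw [hφ, map_mul, map_mul, hφ, hφ]
    map_add' := fun a b => ext fun j => by rw [hφ, map_add, map_add, hφ, hφ]
    commutes' := fun c => ext fun j => by rw [hφ, AlgHomClass.commutes, AlgHomClass.commutes]
    map_star' := fun a => ext fun j => by rw [hφ, map_star, map_star, hφ] }, fun j a => hφ a j⟩

end StarAlgHom

section MinTensor

theorem RepCompletion.uniformContinuous_of_continuous {F : Type u} [Ring F] [StarRing F]
    [Algebra ℂ F] [StarModule ℂ F] {ι : Type v} {H : ι → Type w} [∀ i, NormedAddCommGroup (H i)]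
    [∀ i, InnerProductSpace ℂ (H i)] [∀ i, CompleteSpace (H i)]
    {f : ∀ i, F →⋆ₐ[ℂ] (H i →L[ℂ] H i)} {C : Type*} [Ring C] [UniformSpace C]
    [IsUniformAddGroup C] [StarRing C] [Algebra ℂ C] (g : RepCompletion f →⋆ₐ[ℂ] C)
    (hg : Continuous g) : UniformContinuous g :=
  uniformContinuous_addMonoidHom_of_continuous (f := (g : RepCompletion f →+ C)) hg

variable {A B C D E G : Type u}
  [Ring A] [StarRing A] [Algebra ℂ A] [StarModule ℂ A] [TopologicalSpace A]
  [Ring B] [StarRing B] [Algebra ℂ B] [StarModule ℂ B] [TopologicalSpace B]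
  [Ring C] [StarRing C] [Algebra ℂ C] [StarModule ℂ C] [TopologicalSpace C]
  [Ring D] [StarRing D] [Algebra ℂ D] [StarModule ℂ D] [TopologicalSpace D]
  [Ring E] [StarRing E] [Algebra ℂ E] [StarModule ℂ E] [TopologicalSpace E]
  [Ring G] [StarRing G] [Algebra ℂ G] [StarModule ℂ G] [TopologicalSpace G]

namespace MinTensor

theorem map_map {f : A →⋆ₐ[ℂ] C} (hf : Continuous f) {g : B →⋆ₐ[ℂ] D} (hg : Continuous g)
    {f' : C →⋆ₐ[ℂ] E} (hf' : Continuous f') {g' : D →⋆ₐ[ℂ] G} (hg' : Continuous g')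
    {f'' : A →⋆ₐ[ℂ] E} (hf'' : Continuous f'') {g'' : B →⋆ₐ[ℂ] G} (hg'' : Continuous g'')
    (h : f'.comp f = f'') (h' : g'.comp g = g'') (x : MinTensor A B) :
    map f' hf' g' hg' (map f hf g hg x) = map f'' hf'' g'' hg'' x := by
  suffices (map f' hf' g' hg').comp (map f hf g hg) = map f'' hf'' g'' hg'' from
    DFunLike.congr_fun this x
  refine hom_ext ((continuous_map f' hf' g' hg').comp (continuous_map f hf g hg))
    (continuous_map f'' hf'' g'' hg'') fun a b => ?_
  refine (congrArg (map f' hf' g' hg') (map_tmul f hf g hg a b)).trans <|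
    (map_tmul f' hf' g' hg' (f a) (g b)).trans ?_
  rw [map_tmul, ← h, ← h']
  rfl

theorem denseRange_map {f : A →⋆ₐ[ℂ] C} (hfc : Continuous f) {g : B →⋆ₐ[ℂ] D}
    (hgc : Continuous g) (hf : Function.Surjective f) (hg : Function.Surjective g) :
    DenseRange (map f hfc g hgc) := by
  refine (RepCompletion.dense_range_of (pairRep C D)).mono ?_
  rintro _ ⟨z, rfl⟩
  obtain ⟨w, rfl⟩ := TensorProduct.map_surjective (g := f.toAlgHom.toLinearMap)
    (g' := g.toAlgHom.toLinearMap) hf hg z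
  exact ⟨RepCompletion.of _ w, RepCompletion.map_of ..⟩

end MinTensor

end MinTensor

section Convolve

variable {A B : Type u}
  [Ring A] [StarRing A] [Algebra ℂ A] [StarModule ℂ A] [TopologicalSpace A]
  [Ring B] [StarRing B] [Algebra ℂ B] [StarModule ℂ B] [TopologicalSpace B]
  {f : B →⋆ₐ[ℂ] A} (hf : Continuous f)
  {Δ : A →⋆ₐ[ℂ] MinTensor A A} (hΔ : Continuous Δ)
  {Δ' : B →⋆ₐ[ℂ] MinTensor B B} (hΔ' : Continuous Δ')
  (h : ∀ b, MinTensor.map f hf f hf (Δ' b) = Δ (f b)) (r s t : Rep A)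
include h

theorem Rep.convolve_π_eq_comp
    {π : B →⋆ₐ[ℂ] (r.H →L[ℂ] r.H)} (hπ : Continuous π) (hr : π = r.π.comp f)
    {ρ : B →⋆ₐ[ℂ] (s.H →L[ℂ] s.H)} (hρ : Continuous ρ) (hs : ρ = s.π.comp f) :
    ((⟨r.H, π, hπ⟩ : Rep B).convolve Δ' hΔ' ⟨s.H, ρ, hρ⟩).π =
      (r.convolve Δ hΔ s).π.comp f := by
  subst hr hs
  exact StarAlgHom.ext fun b => (Rep.tensor_map r s f hf f hf (Δ' b)).symm.trans
    (congrArg (r.tensor s) (h b))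

theorem Rep.comp_convolve_assoc
    (hassoc : ∀ a, assocConj r.H s.H t.H (((r.convolve Δ hΔ s).convolve Δ hΔ t).π a) =
      (r.convolve Δ hΔ (s.convolve Δ hΔ t)).π a) (b : B) :
    assocConj r.H s.H t.H
        ((((r.comp f hf).convolve Δ' hΔ' (s.comp f hf)).convolve Δ' hΔ' (t.comp f hf)).π b) =
      ((r.comp f hf).convolve Δ' hΔ' ((s.comp f hf).convolve Δ' hΔ' (t.comp f hf))).π b := by
  let r' := r.comp f hf
  let s' := s.comp f hf
  let t' := t.comp f hf
  have hrs : (r'.convolve Δ' hΔ' s').π = (r.convolve Δ hΔ s).π.comp f :=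
    convolve_π_eq_comp hf hΔ hΔ' h r s r'.continuous_π rfl s'.continuous_π rfl
  have hst : (s'.convolve Δ' hΔ' t').π = (s.convolve Δ hΔ t).π.comp f :=
    convolve_π_eq_comp hf hΔ hΔ' h s t s'.continuous_π rfl t'.continuous_π rfl
  have hrs_t := convolve_π_eq_comp hf hΔ hΔ' h (r.convolve Δ hΔ s) t
    (r'.convolve Δ' hΔ' s').continuous_π hrs t'.continuous_π rfl
  have hr_st := convolve_π_eq_comp hf hΔ hΔ' h r (s.convolve Δ hΔ t)
    r'.continuous_π rfl (s'.convolve Δ' hΔ' t').continuous_π hst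
  exact (congrArg (assocConj r.H s.H t.H) (DFunLike.congr_fun hrs_t b)).trans
    ((hassoc (f b)).trans (DFunLike.congr_fun hr_st b).symm)

end Convolve

section LimitCone

variable {A : ℕ → Type u} [∀ n, Ring (A n)] [∀ n, StarRing (A n)] [∀ n, Algebra ℂ (A n)]
  [∀ n, StarModule ℂ (A n)] [∀ n, TopologicalSpace (A n)]
  {P : Type u} [Ring P] [StarRing P] [Algebra ℂ P] [StarModule ℂ P] [TopologicalSpace P]

/-- A cone of surjective continuous `*`-homomorphisms over an inverse sequence through which all
representations of its vertex factor. This is all that the proofs about tensor squares use of an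
inverse limit of C⋆-algebras, and abstracting it keeps their terms small. -/
structure IsLimitCone (θ : ∀ n, A (n + 1) →⋆ₐ[ℂ] A n) (p : ∀ n, P →⋆ₐ[ℂ] A n) : Prop where
  continuous_connecting : ∀ n, Continuous (θ n)
  continuous : ∀ n, Continuous (p n)
  surjective : ∀ n, Function.Surjective (p n)
  connecting_comp : ∀ n, (θ n).comp (p (n + 1)) = p n
  exists_eq_comp : ∀ r : Rep P, ∃ n, ∀ m, n ≤ m →
    ∃ r' : Rep (A m), r = r'.comp (p m) (continuous m)

namespace IsLimitCone

variable {θ : ∀ n, A (n + 1) →⋆ₐ[ℂ] A n} {p : ∀ n, P →⋆ₐ[ℂ] A n} (c : IsLimitCone θ p)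

include c in
omit [∀ n, StarModule ℂ (A n)] [StarModule ℂ P] in
theorem exists_eq_comp₃ (r s t : Rep P) : ∃ m, ∃ r' s' t' : Rep (A m),
    r = r'.comp (p m) (c.continuous m) ∧ s = s'.comp (p m) (c.continuous m) ∧
      t = t'.comp (p m) (c.continuous m) := by
  obtain ⟨n₁, h₁⟩ := c.exists_eq_comp r
  obtain ⟨n₂, h₂⟩ := c.exists_eq_comp s
  obtain ⟨n₃, h₃⟩ := c.exists_eq_comp t
  obtain ⟨r', hr⟩ := h₁ (max n₁ (max n₂ n₃)) (le_max_left ..)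
  obtain ⟨s', hs⟩ := h₂ (max n₁ (max n₂ n₃)) ((le_max_left ..).trans (le_max_right ..))
  obtain ⟨t', ht⟩ := h₃ (max n₁ (max n₂ n₃)) ((le_max_right ..).trans (le_max_right ..))
  exact ⟨_, r', s', t', hr, hs, ht⟩

/-- The maps `p n ⊗ p n`, forming a cone over the tensor squares. -/
abbrev square (n : ℕ) : MinTensor P P →⋆ₐ[ℂ] MinTensor (A n) (A n) :=
  MinTensor.map (p n) (c.continuous n) (p n) (c.continuous n)

/-- The maps `θ n ⊗ θ n` between the tensor squares. -/
abbrev squareConnecting (n : ℕ) :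
    MinTensor (A (n + 1)) (A (n + 1)) →⋆ₐ[ℂ] MinTensor (A n) (A n) :=
  MinTensor.map (θ n) (c.continuous_connecting n) (θ n) (c.continuous_connecting n)

theorem squareConnecting_square (n : ℕ) (x : MinTensor P P) :
    c.squareConnecting n (c.square (n + 1) x) = c.square n x :=
  MinTensor.map_map _ _ _ _ _ _ (c.connecting_comp n) (c.connecting_comp n) x

theorem isUniformInducing_square :
    IsUniformInducing fun (x : MinTensor P P) n => c.square n x := by
  refine isUniformInducing_of_factor (RepCompletion.isUniformInducing_rep (f := pairRep P P))
    (fun n => RepCompletion.uniformContinuous_of_continuous _ (MinTensor.continuous_map ..)) ?_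
  rintro ⟨r, s⟩
  obtain ⟨n₁, h₁⟩ := c.exists_eq_comp r
  obtain ⟨n₂, h₂⟩ := c.exists_eq_comp s
  obtain ⟨r, rfl⟩ := h₁ (max n₁ n₂) (le_max_left ..)
  obtain ⟨s, rfl⟩ := h₂ (max n₁ n₂) (le_max_right ..)
  exact ⟨_, r.tensor s, RepCompletion.uniformContinuous_of_continuous _ (Rep.continuous_tensor r s),
    fun x => (Rep.tensor_map r s _ _ _ _ x).symm⟩

theorem isEmbedding_square : Topology.IsEmbedding fun (x : MinTensor P P) n => c.square n x :=
  c.isUniformInducing_square.isUniformEmbedding.isEmbedding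

theorem range_square : Set.range (fun (x : MinTensor P P) n => c.square n x) =
    {y | IsCoherent (fun n => c.squareConnecting n) y} :=
  range_eq_setOf_isCoherent (fun _ => MinTensor.continuous_map ..) c.isUniformInducing_square
    (fun x n => c.squareConnecting_square n x)
    fun n => MinTensor.denseRange_map _ _ (c.surjective n) (c.surjective n)

theorem dense_span {X : Set (MinTensor P P)} {Y : ∀ n, Set (MinTensor (A n) (A n))}
    (hY : ∀ n, Dense (Submodule.span ℂ (Y n) : Set (MinTensor (A n) (A n))))
    (hXY : ∀ n, Y n ⊆ c.square n '' X) : Dense (Submodule.span ℂ X : Set (MinTensor P P)) := by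
  refine dense_of_forall_dense_image_apply (fun _ => MinTensor.continuous_map ..)
    c.isEmbedding_square.isInducing (fun x n => c.squareConnecting_square n x)
    fun n => (hY n).mono ?_
  have hspan : Submodule.span ℂ (Y n) ≤
      (Submodule.span ℂ X).map (c.square n).toAlgHom.toLinearMap := by
    rw [Submodule.map_span]
    exact Submodule.span_mono (hXY n)
  exact hspan

variable {Δ : ∀ n, A n →⋆ₐ[ℂ] MinTensor (A n) (A n)}

theorem exists_square_apply_eq
    (hΔ : ∀ n a, c.squareConnecting n (Δ (n + 1) a) = Δ n (θ n a)) :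
    ∃ Δlim : P →⋆ₐ[ℂ] MinTensor P P, ∀ n a, c.square n (Δlim a) = Δ n (p n a) := by
  refine exists_starAlgHom_lift c.square c.isEmbedding_square.injective
    (fun n => (Δ n).comp (p n)) fun a => ?_
  have hcoh : (fun n => Δ n (p n a)) ∈ Set.range fun (x : MinTensor P P) n => c.square n x := by
    rw [c.range_square]
    exact fun n => (hΔ n _).trans (congrArg (Δ n) (DFunLike.congr_fun (c.connecting_comp n) a))
  obtain ⟨x, hx⟩ := hcoh
  exact ⟨x, congrFun hx⟩

variable {Δlim : P →⋆ₐ[ℂ] MinTensor P P} (h : ∀ n a, c.square n (Δlim a) = Δ n (p n a))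
  (hc : ∀ n, Continuous (Δ n))
include h

theorem eq_of_square_apply_eq {Δ' : P →⋆ₐ[ℂ] MinTensor P P}
    (h' : ∀ n a, c.square n (Δ' a) = Δ n (p n a)) : Δ' = Δlim :=
  StarAlgHom.ext fun a => c.isEmbedding_square.injective <| funext fun n =>
    (h' n a).trans (h n a).symm

include hc

theorem continuous_of_square_apply_eq : Continuous Δlim :=
  c.isEmbedding_square.continuous_iff.2 <| continuous_pi fun n =>
    ((hc n).comp (c.continuous n)).congr fun a => (h n a).symm

theorem comulId_eq_idComul (hΔ : ∀ n a, comulId (Δ n) (Δ n a) = idComul (Δ n) (Δ n a)) (a : P) :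
    comulId Δlim (Δlim a) = idComul Δlim (Δlim a) := by
  have hclim := c.continuous_of_square_apply_eq h hc
  refine (coassociative_iff_convolve_assoc Δlim hclim).2 (fun r s t => ?_) a
  obtain ⟨m, r, s, t, rfl, rfl, rfl⟩ := c.exists_eq_comp₃ r s t
  exact Rep.comp_convolve_assoc (c.continuous m) (hc m) hclim (h m) r s t
    ((coassociative_iff_convolve_assoc (Δ m) (hc m)).1 (hΔ m) r s t)

theorem isComultiplication (hΔ : ∀ n, IsComultiplication (Δ n)) : IsComultiplication Δlim := by
  refine ⟨c.comulId_eq_idComul h hc fun n => (hΔ n).1,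
    c.dense_span (fun n => (hΔ n).2.1) fun n => ?_,
    c.dense_span (fun n => (hΔ n).2.2) fun n => ?_⟩ <;>
  · rintro _ ⟨a, b, rfl⟩
    obtain ⟨a, rfl⟩ := c.surjective n a
    obtain ⟨b, rfl⟩ := c.surjective n b
    exact ⟨_, ⟨a, b, rfl⟩, by rw [map_mul, h, MinTensor.map_tmul, map_one]⟩

end IsLimitCone

end LimitCone

section InverseLimit

variable {A : ℕ → Type u} [∀ n, CStarAlgebra (A n)] {θ : ∀ n, A (n + 1) →⋆ₐ[ℂ] A n}

theorem proj_surjective (hθ : ∀ n, Function.Surjective (θ n)) (n : ℕ) :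
    Function.Surjective (proj θ n) := fun a => by
  obtain ⟨x, hx, rfl⟩ := exists_isCoherent_apply_eq n (fun k => θ k) hθ a
  exact ⟨⟨x, hx⟩, rfl⟩

theorem proj_eq_zero_of_le {m n : ℕ} (h : n ≤ m) {x : inverseLimit θ} (hx : proj θ m x = 0) :
    proj θ n x = 0 := by
  induction m, h using Nat.le_induction with
  | base => exact hx
  | succ m _ ih => exact ih ((x.2 m).symm.trans ((congrArg (θ m) hx).trans (map_zero _)))

-- If `x n` lay in the kernel of `proj θ n` but not of `π` for every `n`, then `x n / ‖π (x n)‖`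
-- would tend to zero while its image under `π` has norm one.
theorem exists_proj_ker_le {E : Type*} [NormedRing E] [StarRing E] [NormedAlgebra ℂ E]
    (π : inverseLimit θ →⋆ₐ[ℂ] E) (hπ : Continuous π) :
    ∃ n, ∀ x, proj θ n x = 0 → π x = 0 := by
  by_contra! h
  choose x hx hπx using h
  let y (n : ℕ) : inverseLimit θ := ((‖π (x n)‖⁻¹ : ℝ) : ℂ) • x n
  have hy : Filter.Tendsto y Filter.atTop (nhds 0) := by
    refine tendsto_subtype_rng.2 (tendsto_pi_nhds.2 fun k => tendsto_nhds_of_eventually_eq ?_)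
    filter_upwards [Filter.eventually_ge_atTop k] with n hn
    have : proj θ k (y n) = 0 := by
      rw [map_smul, proj_eq_zero_of_le hn (hx n), smul_zero]
    exact this
  have hnorm (n : ℕ) : ‖π (y n)‖ = 1 := by
    rw [map_smul, norm_smul, Complex.norm_real, norm_inv, norm_norm,
      inv_mul_cancel₀ (norm_ne_zero_iff.2 (hπx n))]
  have hlim : Filter.Tendsto (fun n => ‖π (y n)‖) Filter.atTop (nhds ‖π 0‖) :=
    ((hπ.tendsto 0).comp hy).norm
  rw [map_zero, norm_zero] at hlim
  exact zero_ne_one (tendsto_nhds_unique hlim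
    (tendsto_nhds_of_eventually_eq (Filter.Eventually.of_forall hnorm)))

theorem Rep.exists_eq_comp_proj (hθ : ∀ n, Function.Surjective (θ n)) (r : Rep (inverseLimit θ)) :
    ∃ n, ∀ m, n ≤ m → ∃ r' : Rep (A m), r = r'.comp (proj θ m) (continuous_proj θ m) := by
  obtain ⟨H, π, hπ⟩ := r
  obtain ⟨n, hn⟩ := exists_proj_ker_le π hπ
  refine ⟨n, fun m hm => ?_⟩
  obtain ⟨π', rfl⟩ := exists_starAlgHom_comp_eq (proj θ m) (proj_surjective hθ m) π fun x hx =>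
    hn x (proj_eq_zero_of_le hm hx)
  exact ⟨⟨H, π', map_continuous π'⟩, rfl⟩

theorem isLimitCone_proj (hθ : ∀ n, Function.Surjective (θ n)) : IsLimitCone θ (proj θ) where
  continuous_connecting := continuous_connecting θ
  continuous := continuous_proj θ
  surjective := proj_surjective hθ
  connecting_comp n := StarAlgHom.ext fun x => x.2 n
  exists_eq_comp := Rep.exists_eq_comp_proj hθ

theorem isSigmaCStarAlgebra_inverseLimit (θ : ∀ n, A (n + 1) →⋆ₐ[ℂ] A n) :
    IsSigmaCStarAlgebra (inverseLimit θ) :=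
  ⟨A, inferInstance, θ, StarAlgEquiv.refl .., continuous_id, continuous_id⟩

theorem inverseLimit_quantumGroup {Δ : ∀ n, A n →⋆ₐ[ℂ] MinTensor (A n) (A n)}
    (hθ : ∀ n, Function.Surjective (θ n)) (hΔ : ∀ n, IsCompactQuantumGroup (A n) (Δ n))
    (hs : IsSystemMorphism θ Δ) :
    TensorIsInverseLimit θ ∧
      ∃ Δlim : inverseLimit θ →⋆ₐ[ℂ] MinTensor (inverseLimit θ) (inverseLimit θ),
        IsLimitHom θ Δ Δlim ∧ (∀ Δ', IsLimitHom θ Δ Δ' → Δ' = Δlim) ∧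
        IsSigmaCStarQuantumGroup (inverseLimit θ) Δlim := by
  have c := isLimitCone_proj hθ
  have hc := fun n => RepCompletion.continuous_of_cstarAlgebra (Δ n)
  obtain ⟨Δlim, hlim⟩ := c.exists_square_apply_eq hs
  exact ⟨⟨c.isEmbedding_square, c.range_square⟩, Δlim, hlim,
    fun Δ' h' => c.eq_of_square_apply_eq hlim h', isSigmaCStarAlgebra_inverseLimit θ,
    c.continuous_of_square_apply_eq hlim hc, c.isComultiplication hlim hc hΔ⟩

end InverseLimit

section ConstantLimit

variable (A : Type u) [CStarAlgebra A]

/-- A C⋆-algebra as the inverse limit of the constant sequence. -/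
def constantLimitEquiv :
    A ≃⋆ₐ[ℂ] inverseLimit (A := fun _ : ℕ => A) (fun _ => StarAlgHom.id ℂ A) where
  toFun a := ⟨fun _ => a, fun _ => rfl⟩
  invFun x := x.1 0
  left_inv _ := rfl
  right_inv x := Subtype.ext (funext fun n => by
    induction n with
    | zero => rfl
    | succ n ih => exact ih.trans (x.2 n).symm)
  map_mul' _ _ := rfl
  map_add' _ _ := rfl
  map_star' _ := rfl
  map_smul' _ _ := rfl

theorem isSigmaCStarAlgebra_of_cstarAlgebra : IsSigmaCStarAlgebra A :=
  ⟨fun _ => A, fun _ => inferInstance, fun _ => StarAlgHom.id ℂ A, constantLimitEquiv A,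
    Continuous.subtype_mk (continuous_pi fun _ => continuous_id) _,
    (continuous_apply 0).comp continuous_subtype_val⟩

variable {A}

theorem IsCompactQuantumGroup.isSigmaCStarQuantumGroup {Δ : A →⋆ₐ[ℂ] MinTensor A A}
    (h : IsCompactQuantumGroup A Δ) : IsSigmaCStarQuantumGroup A Δ :=
  ⟨isSigmaCStarAlgebra_of_cstarAlgebra A, RepCompletion.continuous_of_cstarAlgebra Δ, h⟩

end ConstantLimit

section Surjective

variable {A B : Type*} [CStarAlgebra A] [CStarAlgebra B]

theorem exists_map_eq_and_norm_le_of_isSelfAdjoint (φ : A →⋆ₐ[ℂ] B) {a : A}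
    (ha : IsSelfAdjoint a) : ∃ a', φ a' = φ a ∧ ‖a'‖ ≤ ‖φ a‖ := by
  let truncate : ℝ → ℝ := fun x => max (-‖φ a‖) (min x ‖φ a‖)
  have hcont : Continuous truncate := by fun_prop
  have hφa : IsSelfAdjoint (φ a) := ha.map φ
  refine ⟨cfc truncate a, ?_, norm_cfc_le (norm_nonneg _) fun x _ => ?_⟩
  · rw [StarAlgHom.map_cfc φ truncate a hcont.continuousOn (map_continuous φ) ha hφa]
    conv_rhs => rw [← cfc_id' ℝ (φ a)]
    refine cfc_congr fun x hx => ?_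
    have hx' : |x| ≤ ‖φ a‖ := by
      simpa only [cfc_id' ℝ (φ a), Real.norm_eq_abs] using
        norm_apply_le_norm_cfc (fun x : ℝ => x) (φ a) hx
    change max (-‖φ a‖) (min x ‖φ a‖) = x
    rw [min_eq_left (abs_le.1 hx').2, max_eq_right (abs_le.1 hx').1]
  · rw [Real.norm_eq_abs, abs_le]
    exact ⟨le_max_left _ _, max_le (neg_le_self (norm_nonneg _)) (min_le_right _ _)⟩

theorem coe_realPart_map (φ : A →⋆ₐ[ℂ] B) (a : A) : (realPart (φ a) : B) = φ (realPart a) := by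
  rw [realPart_apply_coe, realPart_apply_coe, ← Complex.coe_smul, ← Complex.coe_smul, map_smul,
    map_add, map_star]

theorem coe_imaginaryPart_map (φ : A →⋆ₐ[ℂ] B) (a : A) :
    (imaginaryPart (φ a) : B) = φ (imaginaryPart a) := by
  rw [imaginaryPart_apply_coe, imaginaryPart_apply_coe, ← Complex.coe_smul, ← Complex.coe_smul,
    map_smul, map_smul, map_sub, map_star]

theorem exists_map_eq_and_norm_le (φ : A →⋆ₐ[ℂ] B) (a : A) :
    ∃ a', φ a' = φ a ∧ ‖a'‖ ≤ 2 * ‖φ a‖ := by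
  obtain ⟨b, hb, hb'⟩ := exists_map_eq_and_norm_le_of_isSelfAdjoint φ (realPart a).2
  obtain ⟨c, hc, hc'⟩ := exists_map_eq_and_norm_le_of_isSelfAdjoint φ (imaginaryPart a).2
  rw [← coe_realPart_map] at hb'
  rw [← coe_imaginaryPart_map] at hc'
  refine ⟨b + Complex.I • c, ?_, ?_⟩
  · rw [map_add, map_smul, hb, hc, ← map_smul, ← map_add, realPart_add_I_smul_imaginaryPart]
  · calc ‖b + Complex.I • c‖ ≤ ‖b‖ + ‖c‖ := by
          simpa only [norm_smul, Complex.norm_I, one_mul] using norm_add_le b (Complex.I • c)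
      _ ≤ ‖φ a‖ + ‖φ a‖ := add_le_add (hb'.trans (realPart.norm_le (φ a)))
          (hc'.trans (imaginaryPart.norm_le (φ a)))
      _ = 2 * ‖φ a‖ := (two_mul _).symm

theorem surjective_of_denseRange (φ : A →⋆ₐ[ℂ] B) (h : DenseRange φ) : Function.Surjective φ := by
  let g : NormedAddGroupHom A B := AddMonoidHom.mkNormedAddGroupHom (φ : A →+ B) 1 fun x =>
    (NonUnitalStarAlgHom.norm_apply_le φ x).trans_eq (one_mul ‖x‖).symm
  have hg : g.SurjectiveOnWith (φ : A →+ B).range 2 := by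
    rintro _ ⟨a, rfl⟩
    exact exists_map_eq_and_norm_le φ a
  intro b
  obtain ⟨a, ha, -⟩ := controlled_closure_of_complete two_pos one_pos hg b (h b)
  exact ⟨a, ha⟩

end Surjective

section OrderedProducts

theorem prod_ofFn_sum_mul {B : Type*} [Semiring B] {ι : Type*} [Fintype ι] {N : ℕ}
    (f g : Fin N → ι → B) (h : ∀ k l k' l', Commute (f k l) (g k' l')) :
    (List.ofFn fun k => ∑ l, f k l * g k l).prod =
      ∑ m : Fin N → ι,
        (List.ofFn fun k => f k (m k)).prod * (List.ofFn fun k => g k (m k)).prod := by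
  induction N with
  | zero => simp
  | succ N ih =>
    rw [List.ofFn_succ, List.prod_cons, ih (fun k => f k.succ) (fun k => g k.succ)
      (fun _ _ _ _ => h _ _ _ _), Finset.sum_mul_sum,
      ← (Fin.consEquiv fun _ : Fin (N + 1) => ι).sum_comp, Fintype.sum_prod_type]
    refine Finset.sum_congr rfl fun x _ => Finset.sum_congr rfl fun m _ => ?_
    have hcomm : Commute (g 0 x) (List.ofFn fun k => f (Fin.succ k) (m k)).prod :=
      Commute.list_prod_right _ _ fun y hy => by
        obtain ⟨k, rfl⟩ := List.mem_ofFn.1 hy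
        exact (h _ _ _ _).symm
    simp only [Fin.consEquiv_apply, List.ofFn_succ, List.prod_cons, Fin.cons_zero, Fin.cons_succ]
    exact hcomm.mul_mul_mul_comm _ _

theorem prod_ofFn_eq_prod_ofFn_succAbove {M : Type*} [Monoid M] {n : ℕ} (f : Fin (n + 1) → M)
    (p : Fin (n + 1)) (hp : f p = 1) :
    (List.ofFn f).prod = (List.ofFn fun k => f (p.succAbove k)).prod := by
  induction n with
  | zero => simpa [Fin.fin_one_eq_zero p] using hp
  | succ n ih =>
    cases p using Fin.cases with
    | zero => simp [hp]
    | succ p =>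
      rw [List.ofFn_succ, List.prod_cons, ih (fun k => f k.succ) p hp,
        List.ofFn_succ (f := fun k => f (p.succ.succAbove k)), List.prod_cons]
      simp

end OrderedProducts

section Relations

variable {q : ℝ} {n : ℕ} {B : Type*} [Ring B] [StarRing B] [Algebra ℂ B]

theorem SUqRelations.map {C : Type*} [Ring C] [StarRing C] [Algebra ℂ C] {u : Fin n → Fin n → B}
    (h : SUqRelations q u) (φ : B →⋆ₐ[ℂ] C) : SUqRelations q fun i j => φ (u i j) where
  mul_star i j := by
    simp only [← map_star, ← map_mul, ← map_sum, h.mul_star, apply_ite φ, map_one, map_zero]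
  star_mul i j := by
    simp only [← map_star, ← map_mul, ← map_sum, h.star_mul, apply_ite φ, map_one, map_zero]
  det j := by
    simpa only [map_sum, map_smul, map_list_prod, List.map_ofFn, map_one, Function.comp_def]
      using congrArg φ (h.det j)

theorem SUqRelations.mul {a b : Fin n → Fin n → B} (ha : SUqRelations q a)
    (hb : SUqRelations q b) (h : ∀ i j k l, Commute (a i j) (b k l)) :
    SUqRelations q fun i j => ∑ k, a i k * b k j where
  mul_star i j := by
    calc ∑ k, (∑ l, a i l * b l k) * star (∑ m, a j m * b m k)
        = ∑ l, ∑ m, a i l * (∑ k, b l k * star (b m k)) * star (a j m) := by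
          simp only [star_sum, StarMul.star_mul, Finset.sum_mul_sum]
          rw [Finset.sum_comm]
          refine Finset.sum_congr rfl fun l _ => ?_
          rw [Finset.sum_comm]
          refine Finset.sum_congr rfl fun m _ => ?_
          simp only [Finset.mul_sum, Finset.sum_mul, mul_assoc]
      _ = if i = j then 1 else 0 := by simp [hb.mul_star, ha.mul_star]
  star_mul i j := by
    calc ∑ k, star (∑ l, a k l * b l i) * (∑ m, a k m * b m j)
        = ∑ l, ∑ m, star (b l i) * (∑ k, star (a k l) * a k m) * b m j := by
          simp only [star_sum, StarMul.star_mul, Finset.sum_mul_sum]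
          rw [Finset.sum_comm]
          refine Finset.sum_congr rfl fun l _ => ?_
          rw [Finset.sum_comm]
          refine Finset.sum_congr rfl fun m _ => ?_
          simp only [Finset.mul_sum, Finset.sum_mul, mul_assoc]
      _ = if i = j then 1 else 0 := by simp [hb.star_mul, ha.star_mul]
  det j := by
    calc ∑ i, coeffE q i • (List.ofFn fun k => ∑ l, a (j k) l * b l (i k)).prod
        = ∑ m : Fin n → Fin n, (List.ofFn fun k => a (j k) (m k)).prod *
            ∑ i, coeffE q i • (List.ofFn fun k => b (m k) (i k)).prod := by
          simp only [Finset.mul_sum, mul_smul_comm]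
          rw [Finset.sum_comm]
          refine Finset.sum_congr rfl fun i _ => ?_
          rw [prod_ofFn_sum_mul (fun k l => a (j k) l) (fun k l => b l (i k))
            (fun _ _ _ _ => h _ _ _ _), Finset.smul_sum]
      _ = coeffE q j • (1 : B) := by simp only [hb.det, mul_smul_comm, mul_one, ha.det]

theorem coeffE_of_not_injective {i : Fin n → Fin n} (h : ¬ Function.Injective i) :
    coeffE q i = 0 := if_neg h

theorem coeffE_ne_zero (hq : q ≠ 0) {i : Fin n → Fin n} (h : Function.Injective i) :
    coeffE q i ≠ 0 := by
  rw [coeffE, if_pos h]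
  exact pow_ne_zero _ (Complex.ofReal_ne_zero.2 (neg_ne_zero.2 hq))

theorem coeffE_cons_tail_of_ne {j : Fin (n + 1) → Fin (n + 1)} (hj : Function.Injective j)
    {x : Fin (n + 1)} (hx : x ≠ j 0) :
    coeffE q (Fin.cons x (Fin.tail j) : Fin (n + 1) → Fin (n + 1)) = 0 := by
  obtain ⟨k, rfl⟩ := Finite.injective_iff_surjective.1 hj x
  obtain ⟨k, rfl⟩ := Fin.exists_succ_eq.2 fun h0 : k = 0 => hx (congrArg j h0)
  exact coeffE_of_not_injective fun hinj => Fin.succ_ne_zero k (hinj rfl)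

theorem SUqRelations.sum_cons {u : Fin (n + 1) → Fin (n + 1) → B} (h : SUqRelations q u)
    (x : Fin (n + 1)) (j : Fin n → Fin (n + 1)) :
    ∑ y, ∑ i : Fin n → Fin (n + 1), coeffE q (Fin.cons y i : Fin (n + 1) → Fin (n + 1)) •
        (u x y * (List.ofFn fun k => u (j k) (i k)).prod) =
      coeffE q (Fin.cons x j : Fin (n + 1) → Fin (n + 1)) • (1 : B) := by
  rw [← h.det, ← (Fin.consEquiv fun _ : Fin (n + 1) => Fin (n + 1)).sum_comp,
    Fintype.sum_prod_type]
  simp [Fin.consEquiv]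

-- Quantum Cramer's rule: multiply the determinant relation with first row index `x` by
-- `star (u x m)` and sum over `x`.
theorem SUqRelations.coeffE_smul_star {u : Fin (n + 1) → Fin (n + 1) → B} (h : SUqRelations q u)
    {j : Fin (n + 1) → Fin (n + 1)} (hj : Function.Injective j) (m : Fin (n + 1)) :
    coeffE q j • star (u (j 0) m) = ∑ i : Fin n → Fin (n + 1),
      coeffE q (Fin.cons m i : Fin (n + 1) → Fin (n + 1)) •
        (List.ofFn fun k => u (j k.succ) (i k)).prod := by
  calc coeffE q j • star (u (j 0) m)
      = ∑ x, star (u x m) *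
          (coeffE q (Fin.cons x (Fin.tail j) : Fin (n + 1) → Fin (n + 1)) • (1 : B)) := by
        rw [Fintype.sum_eq_single (j 0) fun x hx => by
          rw [coeffE_cons_tail_of_ne hj hx, zero_smul, mul_zero], Fin.cons_self_tail,
          mul_smul_comm, mul_one]
    _ = ∑ y, ∑ i : Fin n → Fin (n + 1),
          coeffE q (Fin.cons y i : Fin (n + 1) → Fin (n + 1)) •
            ((∑ x, star (u x m) * u x y) * (List.ofFn fun k => u (j k.succ) (i k)).prod) := by
        simp only [← h.sum_cons, Finset.mul_sum, Finset.sum_mul, Finset.smul_sum, mul_smul_comm,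
          mul_assoc, Fin.tail]
        rw [Finset.sum_comm]
        exact Finset.sum_congr rfl fun y _ => Finset.sum_comm
    _ = ∑ i : Fin n → Fin (n + 1), coeffE q (Fin.cons m i : Fin (n + 1) → Fin (n + 1)) •
          (List.ofFn fun k => u (j k.succ) (i k)).prod := by
        simp only [h.star_mul]
        rw [Fintype.sum_eq_single m fun y hy => by
          simp only [if_neg hy.symm, zero_mul, smul_zero, Finset.sum_const_zero]]
        simp only [if_true, one_mul]

theorem SUqRelations.star_mem_adjoin (hq : q ≠ 0) {u : Fin n → Fin n → B}
    (h : SUqRelations q u) (i j : Fin n) :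
    star (u i j) ∈ Algebra.adjoin ℂ (Set.range fun p : Fin n × Fin n => u p.1 p.2) := by
  cases n with
  | zero => exact i.elim0
  | succ n =>
    have hinj := (Equiv.swap 0 i).injective
    have hexpand := h.coeffE_smul_star hinj j
    rw [Equiv.swap_apply_left] at hexpand
    rw [← inv_smul_smul₀ (coeffE_ne_zero hq hinj) (star (u i j)), hexpand]
    refine Subalgebra.smul_mem _ (Subalgebra.sum_mem _ fun k _ => Subalgebra.smul_mem _
      (Subalgebra.list_prod_mem _ fun x hx => ?_) _) _
    obtain ⟨l, rfl⟩ := List.mem_ofFn.1 hx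
    exact Algebra.subset_adjoin ⟨(_, _), rfl⟩

theorem SUqRelations.mem_adjoin_star [StarModule ℂ B] (hq : q ≠ 0) {u : Fin n → Fin n → B}
    (h : SUqRelations q u) (i j : Fin n) :
    u i j ∈ Algebra.adjoin ℂ (Set.range fun p : Fin n × Fin n => star (u p.1 p.2)) := by
  have hstar := h.star_mem_adjoin hq i j
  rw [← Subalgebra.mem_star_iff, Subalgebra.star_adjoin_comm] at hstar
  refine Algebra.adjoin_mono ?_ hstar
  rintro x ⟨p, hp⟩
  exact ⟨p, (congrArg star hp).trans (star_star x)⟩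

end Relations

section InsertLast

variable {n : ℕ}

/-- The multi-index obtained from `i` by inserting the new largest index at position `p`. -/
def insertLast (p : Fin (n + 1)) (i : Fin n → Fin n) : Fin (n + 1) → Fin (n + 1) :=
  p.insertNth (Fin.last n) fun k => (i k).castSucc

@[simp]
theorem insertLast_self (p : Fin (n + 1)) (i : Fin n → Fin n) : insertLast p i p = Fin.last n :=
  Fin.insertNth_apply_same p _ _

@[simp]
theorem insertLast_succAbove (p : Fin (n + 1)) (i : Fin n → Fin n) (k : Fin n) :
    insertLast p i (p.succAbove k) = (i k).castSucc :=
  Fin.insertNth_apply_succAbove p _ _ k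

theorem insertLast_eq_last_iff {p : Fin (n + 1)} {i : Fin n → Fin n} {k : Fin (n + 1)} :
    insertLast p i k = Fin.last n ↔ k = p := by
  rcases Fin.eq_self_or_eq_succAbove p k with rfl | ⟨k, rfl⟩
  · simp only [insertLast_self]
  · simp only [insertLast_succAbove, (Fin.castSucc_lt_last _).ne, Fin.succAbove_ne]

theorem insertLast_injective (p : Fin (n + 1)) :
    Function.Injective (insertLast p : (Fin n → Fin n) → Fin (n + 1) → Fin (n + 1)) :=
  fun i i' h => funext fun k => Fin.castSucc_injective n <| by
    simpa only [insertLast_succAbove] using congrFun h (p.succAbove k)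

theorem exists_insertLast_eq {j : Fin (n + 1) → Fin (n + 1)} {p : Fin (n + 1)}
    (hj : ∀ k, j k = Fin.last n ↔ k = p) : ∃ i, insertLast p i = j := by
  have h : ∀ k, j (p.succAbove k) ≠ Fin.last n := fun k hk => Fin.succAbove_ne p k ((hj _).1 hk)
  refine ⟨fun k => (j (p.succAbove k)).castPred (h k), ?_⟩
  rw [insertLast, eq_comm, Fin.eq_insertNth_iff]
  exact ⟨(hj p).2 rfl, funext fun k => (Fin.castSucc_castPred _ (h k)).symm⟩

theorem exists_insertLast_eq_of_injective {j : Fin (n + 1) → Fin (n + 1)}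
    (hj : Function.Injective j) : ∃ p i, insertLast p i = j := by
  obtain ⟨p, hp⟩ := Finite.injective_iff_surjective.1 hj (Fin.last n)
  exact ⟨p, exists_insertLast_eq fun k => ⟨fun hk => hj (hk.trans hp.symm), fun hk => hk ▸ hp⟩⟩

theorem injective_insertLast_iff {p : Fin (n + 1)} {i : Fin n → Fin n} :
    Function.Injective (insertLast p i) ↔ Function.Injective i := by
  refine ⟨fun h a b hab => p.succAbove_right_injective (h ?_), fun h a b hab => ?_⟩
  · simp only [insertLast_succAbove, hab]
  · rcases Fin.eq_self_or_eq_succAbove p a with rfl | ⟨a, rfl⟩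
    · exact (insertLast_eq_last_iff.1 (hab.symm.trans (insertLast_self a i))).symm
    rcases Fin.eq_self_or_eq_succAbove p b with rfl | ⟨b, rfl⟩
    · exact insertLast_eq_last_iff.1 (hab.trans (insertLast_self b i))
    · rw [insertLast_succAbove, insertLast_succAbove] at hab
      rw [h (Fin.castSucc_injective n hab)]

theorem inversions_insertLast (p : Fin (n + 1)) (i : Fin n → Fin n) :
    inversions (insertLast p i) = (∑ k, if p < p.succAbove k then 1 else 0) + inversions i := by
  simp only [inversions, Finset.card_filter, Fintype.sum_prod_type]
  rw [Fin.sum_univ_succAbove _ p]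
  simp only [Fin.sum_univ_succAbove _ p, insertLast_self, insertLast_succAbove,
    lt_irrefl, if_false, Fin.castSucc_lt_last, and_true, zero_add,
    Fin.castSucc_lt_castSucc_iff, Fin.succAbove_lt_succAbove_iff, (Fin.castSucc_lt_last _).not_gt,
    and_false]

theorem coeffE_insertLast (q : ℝ) (p : Fin (n + 1)) (i : Fin n → Fin n) :
    coeffE q (insertLast p i) =
      ((-q : ℝ) : ℂ) ^ (∑ k, if p < p.succAbove k then 1 else 0) * coeffE q i := by
  rw [coeffE, coeffE, inversions_insertLast, pow_add, mul_ite, mul_zero]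
  simp only [injective_insertLast_iff]

end InsertLast

section BlockMatrix

variable {q : ℝ} {n : ℕ} {B : Type*} [Ring B]

/-- The matrix `diag(u, 1)`, which is the image of the fundamental matrix of `SU_q(n + 1)` under
restriction to `SU_q(n)`. -/
def blockMatrix (u : Fin n → Fin n → B) (i j : Fin (n + 1)) : B :=
  if h : i.val < n ∧ j.val < n then u ⟨i.val, h.1⟩ ⟨j.val, h.2⟩ else if i = j then 1 else 0

variable (u : Fin n → Fin n → B)

@[simp]
theorem blockMatrix_castSucc (i j : Fin n) : blockMatrix u i.castSucc j.castSucc = u i j :=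
  dif_pos ⟨i.2, j.2⟩

@[simp]
theorem blockMatrix_last : blockMatrix u (Fin.last n) (Fin.last n) = 1 := by
  simp [blockMatrix]

@[simp]
theorem blockMatrix_castSucc_last (i : Fin n) : blockMatrix u i.castSucc (Fin.last n) = 0 := by
  simp [blockMatrix, (Fin.castSucc_lt_last i).ne]

@[simp]
theorem blockMatrix_last_castSucc (i : Fin n) : blockMatrix u (Fin.last n) i.castSucc = 0 := by
  simp [blockMatrix, (Fin.castSucc_lt_last i).ne']

theorem blockMatrix_eq_zero {i j : Fin (n + 1)} (h : ¬(i = Fin.last n ↔ j = Fin.last n)) :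
    blockMatrix u i j = 0 := by
  cases i using Fin.lastCases <;> cases j using Fin.lastCases <;>
    simp_all [(Fin.castSucc_lt_last _).ne]

theorem prod_blockMatrix_insertLast (p : Fin (n + 1)) (j i : Fin n → Fin n) :
    (List.ofFn fun k => blockMatrix u (insertLast p j k) (insertLast p i k)).prod =
      (List.ofFn fun k => u (j k) (i k)).prod := by
  rw [prod_ofFn_eq_prod_ofFn_succAbove _ p (by simp)]
  simp

theorem prod_blockMatrix_eq_zero {j i : Fin (n + 1) → Fin (n + 1)}
    (h : ¬∀ k, j k = Fin.last n ↔ i k = Fin.last n) :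
    (List.ofFn fun k => blockMatrix u (j k) (i k)).prod = 0 := by
  obtain ⟨k, hk⟩ := not_forall.1 h
  exact List.prod_eq_zero (List.mem_ofFn.2 ⟨k, blockMatrix_eq_zero u hk⟩)

variable [Algebra ℂ B] {u}

theorem coeffE_smul_prod_blockMatrix_eq_zero {j : Fin (n + 1) → Fin (n + 1)}
    (hj : ∀ p j', insertLast p j' ≠ j) (i : Fin (n + 1) → Fin (n + 1)) :
    coeffE q i • (List.ofFn fun k => blockMatrix u (j k) (i k)).prod = 0 := by
  by_cases hi : Function.Injective i
  · obtain ⟨p, i, rfl⟩ := exists_insertLast_eq_of_injective hi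
    rw [prod_blockMatrix_eq_zero u fun hji => ?_, smul_zero]
    obtain ⟨j', hj'⟩ := exists_insertLast_eq fun k => (hji k).trans insertLast_eq_last_iff
    exact hj p j' hj'
  · rw [coeffE_of_not_injective hi, zero_smul]

variable [StarRing B]

theorem SUqRelations.blockMatrix_det_insertLast (h : SUqRelations q u) (p : Fin (n + 1))
    (j : Fin n → Fin n) :
    ∑ i : Fin (n + 1) → Fin (n + 1),
        coeffE q i • (List.ofFn fun k => blockMatrix u (insertLast p j k) (i k)).prod =
      coeffE q (insertLast p j) • (1 : B) := by
  rw [coeffE_insertLast, mul_smul, ← h.det j, Finset.smul_sum]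
  refine (Fintype.sum_of_injective (insertLast p) (insertLast_injective p) _ _
    (fun i hi => ?_) fun i => ?_).symm
  · rw [prod_blockMatrix_eq_zero u fun hji => hi (exists_insertLast_eq fun k =>
      (hji k).symm.trans insertLast_eq_last_iff), smul_zero]
  · rw [prod_blockMatrix_insertLast, coeffE_insertLast, mul_smul]

theorem SUqRelations.blockMatrix (h : SUqRelations q u) : SUqRelations q (blockMatrix u) where
  mul_star i j := by
    cases i using Fin.lastCases <;> cases j using Fin.lastCases <;>
      simp [Fin.sum_univ_castSucc, h.mul_star, (Fin.castSucc_lt_last _).ne,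
        (Fin.castSucc_lt_last _).ne']
  star_mul i j := by
    cases i using Fin.lastCases <;> cases j using Fin.lastCases <;>
      simp [Fin.sum_univ_castSucc, h.star_mul, (Fin.castSucc_lt_last _).ne,
        (Fin.castSucc_lt_last _).ne']
  det j := by
    by_cases hj : ∃ p j', insertLast p j' = j
    · obtain ⟨p, j, rfl⟩ := hj
      exact h.blockMatrix_det_insertLast p j
    · rw [coeffE_of_not_injective (mt exists_insertLast_eq_of_injective hj), zero_smul]
      push Not at hj
      exact Finset.sum_eq_zero fun i _ => coeffE_smul_prod_blockMatrix_eq_zero hj i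

end BlockMatrix

theorem FreeStar.adjoin_range_gen (X : Type) :
    StarAlgebra.adjoin ℂ (Set.range (FreeStar.gen : X → FreeStar X)) = ⊤ := by
  refine StarSubalgebra.eq_top_iff.2 fun x => ?_
  have hgen (y : X) : FreeStar.gen y ∈ StarAlgebra.adjoin ℂ (Set.range FreeStar.gen) :=
    StarAlgebra.subset_adjoin ℂ _ ⟨y, rfl⟩
  induction x using freeStar_induction with
  | hc c => exact algebraMap_mem _ c
  | hι y =>
    rcases y with y | y
    · exact hgen y
    · rw [← Sum.swap_inl, ← freeStar_star_ι]
      exact star_mem (hgen y)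
  | hm x y hx hy => exact mul_mem hx hy
  | ha x y hx hy => exact add_mem hx hy

section UniversalProperty

variable {q : ℝ} {n : ℕ}

/-- The generators `u_{ij}` of the free `*`-algebra. -/
def PreSUq.gen (q : ℝ) {n : ℕ} (i j : Fin n) : PreSUq q n := FreeStar.gen (i, j)

theorem PreSUq.eval_gen {B : Type*} [Ring B] [StarRing B] [Algebra ℂ B] [StarModule ℂ B]
    (u : Fin n → Fin n → B) (i j : Fin n) : PreSUq.eval u (PreSUq.gen q i j) = u i j :=
  FreeStar.lift_gen _ _

theorem PreSUq.adjoin_range_gen :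
    StarAlgebra.adjoin ℂ (Set.range fun p : Fin n × Fin n => PreSUq.gen q p.1 p.2) = ⊤ :=
  FreeStar.adjoin_range_gen (Fin n × Fin n)

theorem PreSUq.hom_ext {B : Type*} [Semiring B] [StarRing B] [Algebra ℂ B]
    {φ ψ : PreSUq q n →⋆ₐ[ℂ] B} (h : ∀ i j, φ (PreSUq.gen q i j) = ψ (PreSUq.gen q i j)) :
    φ = ψ :=
  StarAlgHom.ext_of_adjoin_eq_top PreSUq.adjoin_range_gen fun _ ⟨p, hp⟩ => hp ▸ h p.1 p.2

variable (q n) in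
/-- The canonical map from the free `*`-algebra to `C(SU_q(n))`. -/
def CSUq.of : PreSUq q n →⋆ₐ[ℂ] CSUq q n where
  toFun x := (x : Completion (PreSUq q n))
  map_one' := coe_one _
  map_mul' := coe_mul
  map_zero' := coe_zero
  map_add' := coe_add
  commutes' _ := rfl
  map_star' := coe_star

theorem CSUq.of_gen (i j : Fin n) : CSUq.of q n (PreSUq.gen q i j) = CSUq.gen q n i j := rfl

theorem CSUq.denseRange_of : DenseRange (CSUq.of q n) :=
  denseRange_coe (α := PreSUq q n)

theorem CSUq.norm_of (x : PreSUq q n) : ‖CSUq.of q n x‖ = suqSeminorm q n x := norm_coe x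

theorem CSUq.of_eq_of {x y : PreSUq q n}
    (h : ∀ (B : Type) [CStarAlgebra B] (u : Fin n → Fin n → B), SUqRelations q u →
      PreSUq.eval u x = PreSUq.eval u y) : CSUq.of q n x = CSUq.of q n y := by
  rw [← sub_eq_zero, ← map_sub, ← norm_le_zero_iff, CSUq.norm_of]
  exact suqSeminorm_le le_rfl fun B _ u hu => by rw [map_sub, h B u hu, sub_self, norm_zero]

variable (q n) in
theorem CSUq.relations : SUqRelations q (CSUq.gen q n) where
  mul_star i j := by
    have := CSUq.of_eq_of (x := ∑ k, PreSUq.gen q i k * star (PreSUq.gen q j k))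
      (y := if i = j then 1 else 0) fun B _ u hu => by
        simp only [map_sum, map_mul, map_star, PreSUq.eval_gen, hu.mul_star,
          apply_ite (PreSUq.eval u), map_one, map_zero]
    simpa only [map_sum, map_mul, map_star, CSUq.of_gen, apply_ite (CSUq.of q n), map_one,
      map_zero] using this
  star_mul i j := by
    have := CSUq.of_eq_of (x := ∑ k, star (PreSUq.gen q k i) * PreSUq.gen q k j)
      (y := if i = j then 1 else 0) fun B _ u hu => by
        simp only [map_sum, map_mul, map_star, PreSUq.eval_gen, hu.star_mul,
          apply_ite (PreSUq.eval u), map_one, map_zero]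
    simpa only [map_sum, map_mul, map_star, CSUq.of_gen, apply_ite (CSUq.of q n), map_one,
      map_zero] using this
  det j := by
    have := CSUq.of_eq_of (x := ∑ i : Fin n → Fin n,
        coeffE q i • (List.ofFn fun k => PreSUq.gen q (j k) (i k)).prod)
      (y := coeffE q j • (1 : PreSUq q n)) fun B _ u hu => by
        simpa only [map_sum, map_smul, map_list_prod, List.map_ofFn, map_one, Function.comp_def,
          PreSUq.eval_gen] using hu.det j
    simpa only [map_sum, map_smul, map_list_prod, List.map_ofFn, map_one, Function.comp_def,
      CSUq.of_gen] using this

theorem CSUq.dense_of_gen_mem {R : StarSubalgebra ℂ (CSUq q n)}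
    (h : ∀ i j, CSUq.gen q n i j ∈ R) : Dense (R : Set (CSUq q n)) := by
  have hR : StarAlgebra.adjoin ℂ (Set.range fun p : Fin n × Fin n => PreSUq.gen q p.1 p.2) ≤
      R.comap (CSUq.of q n) :=
    StarAlgebra.adjoin_le (by rintro _ ⟨p, rfl⟩; exact h p.1 p.2)
  rw [PreSUq.adjoin_range_gen] at hR
  exact CSUq.denseRange_of.mono (by rintro _ ⟨x, rfl⟩; exact hR trivial)

theorem CSUq.hom_ext {C : Type*} [Semiring C] [StarRing C] [Algebra ℂ C] [TopologicalSpace C]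
    [T2Space C] {φ ψ : CSUq q n →⋆ₐ[ℂ] C} (hφ : Continuous φ) (hψ : Continuous ψ)
    (h : ∀ i j, φ (CSUq.gen q n i j) = ψ (CSUq.gen q n i j)) : φ = ψ := by
  have hof : φ.comp (CSUq.of q n) = ψ.comp (CSUq.of q n) := PreSUq.hom_ext h
  exact DFunLike.coe_injective
    (CSUq.denseRange_of.equalizer hφ hψ (congrArg DFunLike.coe hof))

section Lift

variable {C : Type*} [Ring C] [UniformSpace C] [IsUniformAddGroup C] [StarRing C]
  [ContinuousStar C] [IsTopologicalRing C] [Algebra ℂ C] [StarModule ℂ C] [CompleteSpace C]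
  [T0Space C] (v : Fin n → Fin n → C)

/-- The homomorphism on `C(SU_q(n))` that maps the generators to the entries of `v`. -/
def CSUq.lift (hc : Continuous (PreSUq.eval (q := q) v)) : CSUq q n →⋆ₐ[ℂ] C :=
  completionLift (PreSUq.eval (q := q) v) hc

theorem CSUq.lift_gen (hc : Continuous (PreSUq.eval (q := q) v)) (i j : Fin n) :
    CSUq.lift v hc (CSUq.gen q n i j) = v i j :=
  (completionLift_coe (PreSUq.eval (q := q) v) hc _).trans (PreSUq.eval_gen v i j)

end Lift

theorem PreSUq.continuous_eval {B : Type} [CStarAlgebra B] {v : Fin n → Fin n → B}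
    (hv : SUqRelations q v) : Continuous (PreSUq.eval (q := q) v) :=
  AddMonoidHomClass.continuous_of_bound (PreSUq.eval (q := q) v) 1 fun x =>
    (norm_le_suqSeminorm hv x).trans (one_mul ‖x‖).ge

theorem CSUq.existsUnique_hom {B : Type} [CStarAlgebra B] {v : Fin n → Fin n → B}
    (hv : SUqRelations q v) :
    ∃! φ : CSUq q n →⋆ₐ[ℂ] B, ∀ i j, φ (CSUq.gen q n i j) = v i j :=
  ⟨CSUq.lift v (PreSUq.continuous_eval hv), CSUq.lift_gen v _, fun ψ hψ =>
    CSUq.hom_ext (map_continuous ψ) (map_continuous _) fun i j =>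
      (hψ i j).trans (CSUq.lift_gen v _ i j).symm⟩

theorem PreSUq.continuous_eval_repCompletion {F : Type u} [Ring F] [StarRing F] [Algebra ℂ F]
    [StarModule ℂ F] {ι : Type v} {H : ι → Type} [∀ i, NormedAddCommGroup (H i)]
    [∀ i, InnerProductSpace ℂ (H i)] [∀ i, CompleteSpace (H i)]
    {f : ∀ i, F →⋆ₐ[ℂ] (H i →L[ℂ] H i)} {w : Fin n → Fin n → RepCompletion f}
    (hw : SUqRelations q w) : Continuous (PreSUq.eval (q := q) w) := by
  refine RepCompletion.continuous_iff_rep.2 fun i => ?_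
  have heval : PreSUq.eval (q := q) (fun k l => RepCompletion.rep f i (w k l)) =
      (RepCompletion.rep f i).comp (PreSUq.eval w) :=
    PreSUq.hom_ext fun k l => by
      rw [PreSUq.eval_gen, StarAlgHom.comp_apply, PreSUq.eval_gen]
  exact (PreSUq.continuous_eval (hw.map (RepCompletion.rep f i))).congr
    (DFunLike.congr_fun heval)

end UniversalProperty

section Tmul

variable {A B C : Type u}
  [Ring A] [StarRing A] [Algebra ℂ A] [StarModule ℂ A] [TopologicalSpace A]
  [Ring B] [StarRing B] [Algebra ℂ B] [StarModule ℂ B] [TopologicalSpace B]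
  [Ring C] [StarRing C] [Algebra ℂ C] [StarModule ℂ C] [TopologicalSpace C]

variable (A B) in
/-- The homomorphism `a ↦ a ⊗ 1` into the minimal tensor product. -/
def tmulLeft : A →⋆ₐ[ℂ] MinTensor A B := (RepCompletion.of (pairRep A B)).comp inclLeft

variable (A B) in
/-- The homomorphism `b ↦ 1 ⊗ b` into the minimal tensor product. -/
def tmulRight : B →⋆ₐ[ℂ] MinTensor A B := (RepCompletion.of (pairRep A B)).comp inclRight

theorem tmulLeft_apply (a : A) : tmulLeft A B a = tmul a 1 := rfl

theorem tmulRight_apply (b : B) : tmulRight A B b = tmul 1 b := rfl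

theorem tmul_mul_tmul (a a' : A) (b b' : B) : tmul a b * tmul a' b' = tmul (a * a') (b * b') := by
  rw [tmul, tmul, tmul, ← map_mul, Algebra.TensorProduct.tmul_mul_tmul]

theorem tmulLeft_mul_tmulRight (a : A) (b : B) : tmulLeft A B a * tmulRight A B b = tmul a b := by
  rw [tmulLeft_apply, tmulRight_apply, tmul_mul_tmul, mul_one, one_mul]

theorem commute_tmulLeft_tmulRight (a : A) (b : B) :
    Commute (tmulLeft A B a) (tmulRight A B b) := by
  rw [Commute, SemiconjBy, tmulLeft_mul_tmulRight, tmulLeft_apply, tmulRight_apply,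
    tmul_mul_tmul, one_mul, mul_one]

theorem continuous_tmulLeft : Continuous (tmulLeft A B) :=
  RepCompletion.continuous_iff_rep.2 fun ⟨r, s⟩ =>
    ((continuous_ampLeft r.H s.H).comp r.continuous_π).congr fun a =>
      ((Rep.tensor_tmul r s a 1).trans (by rw [map_one]; rfl)).symm

theorem continuous_tmulRight : Continuous (tmulRight A B) :=
  RepCompletion.continuous_iff_rep.2 fun ⟨r, s⟩ =>
    ((continuous_ampRight r.H s.H).comp s.continuous_π).congr fun b =>
      ((Rep.tensor_tmul r s 1 b).trans (by rw [map_one]; rfl)).symm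

theorem dense_of_forall_tmul_mem_closure {T : AddSubgroup (MinTensor A B)}
    (h : ∀ a b, tmul a b ∈ closure (T : Set (MinTensor A B))) :
    Dense (T : Set (MinTensor A B)) := by
  rw [← dense_closure]
  refine (RepCompletion.dense_range_of (pairRep A B)).mono ?_
  rintro _ ⟨z, rfl⟩
  change _ ∈ T.topologicalClosure
  induction z using TensorProduct.induction_on with
  | zero => rw [map_zero]; exact zero_mem _
  | add x y hx hy => rw [map_add]; exact add_mem hx hy
  | tmul a b => exact h a b

theorem leg₁₂_tmul_mul_leg₃ (a : A) (b : B) (c : C) :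
    leg₁₂ A B C (tmul a b) * leg₃ A B C c = leg₁ A B C a * leg₂₃ A B C (tmul b c) := by
  rw [tmul, tmul, leg₁₂_of, leg₂₃_of]
  change _ * RepCompletion.of (tripleRep A B C) ((1 : A ⊗[ℂ] B) ⊗ₜ[ℂ] c) =
    RepCompletion.of (tripleRep A B C) ((a ⊗ₜ[ℂ] (1 : B)) ⊗ₜ[ℂ] (1 : C)) *
      RepCompletion.of (tripleRep A B C) (((1 : A) ⊗ₜ[ℂ] b) ⊗ₜ[ℂ] c)
  rw [← map_mul, ← map_mul]
  simp only [Algebra.TensorProduct.tmul_mul_tmul, mul_one, one_mul]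

end Tmul

section Density

variable {A M : Type*} [Ring A] [StarRing A] [Algebra ℂ A] [Ring M] [StarRing M] [Algebra ℂ M]
  {Δ κ κ' : A →⋆ₐ[ℂ] M}

variable (Δ κ) in
/-- The linear span of the products `Δ(a) κ(b)`. For the two embeddings `κ` of `A` into `A ⊗ A`
this is the span that has to be dense in a quantum group. -/
def productSpan : Submodule ℂ M := Submodule.span ℂ {x | ∃ a b, x = Δ a * κ b}

theorem mul_mem_productSpan (a b : A) : Δ a * κ b ∈ productSpan Δ κ :=
  Submodule.subset_span ⟨a, b, rfl⟩

theorem mul_mul_mem_productSpan (a b : A) {x : M} (hx : x ∈ productSpan Δ κ) :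
    Δ a * x * κ b ∈ productSpan Δ κ := by
  induction hx using Submodule.span_induction with
  | mem x hx =>
    obtain ⟨c, d, rfl⟩ := hx
    simpa only [map_mul, mul_assoc] using mul_mem_productSpan (Δ := Δ) (κ := κ) (a * c) (d * b)
  | zero => rw [mul_zero, zero_mul]; exact zero_mem _
  | add x y _ _ hx hy => rw [mul_add, add_mul]; exact add_mem hx hy
  | smul c x _ hx => rw [mul_smul_comm, smul_mul_assoc]; exact Submodule.smul_mem _ c hx

theorem mul_mem_productSpan_of_commute (h : ∀ a b, Commute (κ a) (κ' b)) {x : M}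
    (hx : x ∈ productSpan Δ κ) {b : A} (hb : κ' b ∈ productSpan Δ κ) :
    x * κ' b ∈ productSpan Δ κ := by
  induction hx using Submodule.span_induction with
  | mem x hx =>
    obtain ⟨c, d, rfl⟩ := hx
    rw [mul_assoc, (h d b).eq, ← mul_assoc]
    exact mul_mul_mem_productSpan c d hb
  | zero => rw [zero_mul]; exact zero_mem _
  | add x y _ _ hx hy => rw [add_mul]; exact add_mem hx hy
  | smul c x _ hx => rw [smul_mul_assoc]; exact Submodule.smul_mem _ c hx

variable (Δ) in
/-- The algebra of the elements `a` for which `κ'(a)` is a linear combination of products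
`Δ(b) κ(c)`, for homomorphisms `κ` and `κ'` with commuting ranges. It reduces the density of
`productSpan Δ κ` to a statement about generators. -/
def productSpanSubalgebra (h : ∀ a b, Commute (κ a) (κ' b)) : Subalgebra ℂ A where
  carrier := {a | κ' a ∈ productSpan Δ κ}
  mul_mem' ha hb := by
    simpa only [Set.mem_ofPred_eq, map_mul] using mul_mem_productSpan_of_commute h ha hb
  add_mem' ha hb := by
    simpa only [Set.mem_ofPred_eq, map_add] using add_mem ha hb
  algebraMap_mem' c := by
    simpa only [Set.mem_ofPred_eq, AlgHomClass.commutes, map_one, mul_one] using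
      mul_mem_productSpan (Δ := Δ) (κ := κ) (algebraMap ℂ A c) 1

theorem mem_productSpanSubalgebra (h : ∀ a b, Commute (κ a) (κ' b)) {a : A} :
    a ∈ productSpanSubalgebra Δ h ↔ κ' a ∈ productSpan Δ κ := Iff.rfl

theorem mul_mem_closure_productSpan [TopologicalSpace A] [TopologicalSpace M] [IsTopologicalRing M]
    (h : ∀ a b, Commute (κ a) (κ' b)) (hκ' : Continuous κ')
    (hd : Dense (productSpanSubalgebra Δ h : Set A)) (a b : A) :
    κ' a * κ b ∈ closure (productSpan Δ κ : Set M) :=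
  map_mem_closure (f := fun a => κ' a * κ b) (hκ'.mul continuous_const) (hd a) fun c hc => by
    simpa only [map_one, one_mul, SetLike.mem_coe] using mul_mul_mem_productSpan (1 : A) b hc

end Density

section SUqQuantumGroup

variable {q : ℝ} {n : ℕ}

variable (q n) in
theorem CSUq.comul_relations : SUqRelations q fun i j : Fin n =>
    ∑ k, tmul (CSUq.gen q n i k) (CSUq.gen q n k j) := by
  have h := ((CSUq.relations q n).map (tmulLeft (CSUq q n) (CSUq q n))).mul
    ((CSUq.relations q n).map (tmulRight (CSUq q n) (CSUq q n)))
    fun i j k l => commute_tmulLeft_tmulRight _ _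
  simpa only [tmulLeft_mul_tmulRight] using h

variable (q n) in
/-- The comultiplication of `C(SU_q(n))`. -/
def CSUq.comul : CSUq q n →⋆ₐ[ℂ] MinTensor (CSUq q n) (CSUq q n) :=
  CSUq.lift _ (PreSUq.continuous_eval_repCompletion (CSUq.comul_relations q n))

theorem CSUq.comul_gen (i j : Fin n) : CSUq.comul q n (CSUq.gen q n i j) =
    ∑ k, tmul (CSUq.gen q n i k) (CSUq.gen q n k j) :=
  CSUq.lift_gen _ _ i j

theorem CSUq.continuous_comul : Continuous (CSUq.comul q n) :=
  RepCompletion.continuous_of_cstarAlgebra _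

theorem CSUq.comulId_comul (a : CSUq q n) :
    comulId (CSUq.comul q n) (CSUq.comul q n a) = idComul (CSUq.comul q n) (CSUq.comul q n a) := by
  have hc := CSUq.continuous_comul (q := q) (n := n)
  suffices h : (comulIdHom _ hc).comp (CSUq.comul q n) = (idComulHom _ hc).comp (CSUq.comul q n)
    from DFunLike.congr_fun h a
  refine CSUq.hom_ext ((continuous_comulIdHom _ hc).comp hc)
    ((continuous_idComulHom _ hc).comp hc) fun i j => ?_
  simp only [StarAlgHom.comp_apply, CSUq.comul_gen, map_sum, comulIdHom_tmul, idComulHom_tmul,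
    Finset.sum_mul, Finset.mul_sum, leg₁₂_tmul_mul_leg₃]
  exact Finset.sum_comm

theorem CSUq.dense_of_gen_mem_of_star_gen_mem {R : Subalgebra ℂ (CSUq q n)}
    (h : ∀ i j, CSUq.gen q n i j ∈ R) (hstar : ∀ i j, star (CSUq.gen q n i j) ∈ R) :
    Dense (R : Set (CSUq q n)) := by
  let S := StarAlgebra.adjoin ℂ (Set.range fun p : Fin n × Fin n => CSUq.gen q n p.1 p.2)
  have hS : Dense (S : Set (CSUq q n)) := CSUq.dense_of_gen_mem fun i j =>
    StarAlgebra.subset_adjoin ℂ _ ⟨(i, j), rfl⟩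
  have hSR : S.toSubalgebra ≤ R := Algebra.adjoin_le (Set.union_subset
    (Set.range_subset_iff.2 fun p => h p.1 p.2) (by
      rw [Set.star_subset]
      rintro _ ⟨p, rfl⟩
      exact hstar p.1 p.2))
  exact hS.mono hSR

theorem CSUq.dense_of_forall_gen_mem (hq : q ≠ 0) {R : Subalgebra ℂ (CSUq q n)}
    (h : ∀ i j, CSUq.gen q n i j ∈ R) : Dense (R : Set (CSUq q n)) :=
  CSUq.dense_of_gen_mem_of_star_gen_mem h fun i j => Algebra.adjoin_le
    (by rintro _ ⟨p, rfl⟩; exact h p.1 p.2) ((CSUq.relations q n).star_mem_adjoin hq i j)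

theorem CSUq.dense_of_forall_star_gen_mem (hq : q ≠ 0) {R : Subalgebra ℂ (CSUq q n)}
    (h : ∀ i j, star (CSUq.gen q n i j) ∈ R) : Dense (R : Set (CSUq q n)) :=
  CSUq.dense_of_gen_mem_of_star_gen_mem (fun i j => Algebra.adjoin_le
    (by rintro _ ⟨p, rfl⟩; exact h p.1 p.2) ((CSUq.relations q n).mem_adjoin_star hq i j)) h

theorem CSUq.tmulLeft_gen (i j : Fin n) : tmulLeft (CSUq q n) (CSUq q n) (CSUq.gen q n i j) =
    ∑ k, CSUq.comul q n (CSUq.gen q n i k) *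
      tmulRight (CSUq q n) (CSUq q n) (star (CSUq.gen q n j k)) := by
  symm
  calc ∑ k, CSUq.comul q n (CSUq.gen q n i k) *
        tmulRight (CSUq q n) (CSUq q n) (star (CSUq.gen q n j k))
      = ∑ l, tmulLeft (CSUq q n) (CSUq q n) (CSUq.gen q n i l) * tmulRight (CSUq q n) (CSUq q n)
          (∑ k, CSUq.gen q n l k * star (CSUq.gen q n j k)) := by
        simp only [CSUq.comul_gen, ← tmulLeft_mul_tmulRight, map_sum, map_mul, Finset.sum_mul,
          Finset.mul_sum, mul_assoc]
        exact Finset.sum_comm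
    _ = tmulLeft (CSUq q n) (CSUq q n) (CSUq.gen q n i j) := by
        simp [(CSUq.relations q n).mul_star, apply_ite]

theorem CSUq.tmulRight_star_gen (i j : Fin n) :
    tmulRight (CSUq q n) (CSUq q n) (star (CSUq.gen q n i j)) =
      ∑ k, CSUq.comul q n (star (CSUq.gen q n k j)) *
        tmulLeft (CSUq q n) (CSUq q n) (CSUq.gen q n k i) := by
  symm
  calc ∑ k, CSUq.comul q n (star (CSUq.gen q n k j)) *
        tmulLeft (CSUq q n) (CSUq q n) (CSUq.gen q n k i)
      = ∑ l, tmulRight (CSUq q n) (CSUq q n) (star (CSUq.gen q n l j)) *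
          tmulLeft (CSUq q n) (CSUq q n)
            (∑ k, star (CSUq.gen q n k l) * CSUq.gen q n k i) := by
        simp only [map_star, CSUq.comul_gen, ← tmulLeft_mul_tmulRight, star_sum, star_mul, map_sum,
          map_mul, Finset.sum_mul, Finset.mul_sum, mul_assoc]
        exact Finset.sum_comm
    _ = tmulRight (CSUq q n) (CSUq q n) (star (CSUq.gen q n i j)) := by
        simp [(CSUq.relations q n).star_mul, apply_ite]

theorem CSUq.dense_productSpan_tmulLeft (hq : q ≠ 0) :
    Dense (productSpan (CSUq.comul q n) (tmulLeft (CSUq q n) (CSUq q n)) :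
      Set (MinTensor (CSUq q n) (CSUq q n))) := by
  have hcomm := commute_tmulLeft_tmulRight (A := CSUq q n) (B := CSUq q n)
  have hdense : Dense (productSpanSubalgebra (CSUq.comul q n) hcomm : Set (CSUq q n)) :=
    CSUq.dense_of_forall_star_gen_mem hq fun i j => by
      rw [mem_productSpanSubalgebra, CSUq.tmulRight_star_gen]
      exact sum_mem fun k _ => mul_mem_productSpan _ _
  refine dense_of_forall_tmul_mem_closure
    (T := (productSpan (CSUq.comul q n) (tmulLeft _ _)).toAddSubgroup) fun a b => ?_
  rw [← tmulLeft_mul_tmulRight, (hcomm a b).eq]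
  exact mul_mem_closure_productSpan hcomm continuous_tmulRight hdense b a

theorem CSUq.dense_productSpan_tmulRight (hq : q ≠ 0) :
    Dense (productSpan (CSUq.comul q n) (tmulRight (CSUq q n) (CSUq q n)) :
      Set (MinTensor (CSUq q n) (CSUq q n))) := by
  have hcomm (b a) := (commute_tmulLeft_tmulRight (A := CSUq q n) (B := CSUq q n) a b).symm
  have hdense : Dense (productSpanSubalgebra (CSUq.comul q n) hcomm : Set (CSUq q n)) :=
    CSUq.dense_of_forall_gen_mem hq fun i j => by
      rw [mem_productSpanSubalgebra, CSUq.tmulLeft_gen]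
      exact sum_mem fun k _ => mul_mem_productSpan _ _
  refine dense_of_forall_tmul_mem_closure
    (T := (productSpan (CSUq.comul q n) (tmulRight _ _)).toAddSubgroup) fun a b => ?_
  rw [← tmulLeft_mul_tmulRight]
  exact mul_mem_closure_productSpan hcomm continuous_tmulLeft hdense a b

theorem CSUq.isCompactQuantumGroup (hq : q ≠ 0) :
    IsCompactQuantumGroup (CSUq q n) (CSUq.comul q n) :=
  ⟨CSUq.comulId_comul, CSUq.dense_productSpan_tmulLeft hq, CSUq.dense_productSpan_tmulRight hq⟩

variable (q n) in
/-- The homomorphism `C(SU_q(n + 1)) → C(SU_q(n))` that belongs to the matrix `diag(u, 1)`; it is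
the restriction of functions to the quantum subgroup `SU_q(n)`. -/
def CSUq.restrict : CSUq q (n + 1) →⋆ₐ[ℂ] CSUq q n :=
  CSUq.lift _ (PreSUq.continuous_eval (CSUq.relations q n).blockMatrix)

theorem CSUq.restrict_gen (i j : Fin (n + 1)) :
    CSUq.restrict q n (CSUq.gen q (n + 1) i j) = blockMatrix (CSUq.gen q n) i j :=
  CSUq.lift_gen _ _ i j

theorem CSUq.continuous_restrict : Continuous (CSUq.restrict q n) := map_continuous _

theorem CSUq.restrict_surjective : Function.Surjective (CSUq.restrict q n) :=
  surjective_of_denseRange _ <| CSUq.dense_of_gen_mem (R := (CSUq.restrict q n).range) fun i j =>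
    ⟨CSUq.gen q (n + 1) i.castSucc j.castSucc,
      (CSUq.restrict_gen _ _).trans (blockMatrix_castSucc _ i j)⟩

theorem CSUq.map_restrict_comul (a : CSUq q (n + 1)) :
    MinTensor.map (CSUq.restrict q n) CSUq.continuous_restrict (CSUq.restrict q n)
      CSUq.continuous_restrict (CSUq.comul q (n + 1) a) =
    CSUq.comul q n (CSUq.restrict q n a) := by
  have hr := CSUq.continuous_restrict (q := q) (n := n)
  suffices h : (MinTensor.map (CSUq.restrict q n) hr (CSUq.restrict q n) hr).comp
      (CSUq.comul q (n + 1)) = (CSUq.comul q n).comp (CSUq.restrict q n)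
    from DFunLike.congr_fun h a
  refine CSUq.hom_ext
    ((MinTensor.continuous_map (CSUq.restrict q n) hr _ hr).comp CSUq.continuous_comul)
    (CSUq.continuous_comul.comp hr) fun i j => ?_
  rw [StarAlgHom.comp_apply, StarAlgHom.comp_apply, CSUq.comul_gen, map_sum, CSUq.restrict_gen]
  simp only [MinTensor.map_tmul, CSUq.restrict_gen, Fin.sum_univ_castSucc]
  cases i using Fin.lastCases <;> cases j using Fin.lastCases <;>
    simp [CSUq.comul_gen, ← tmulLeft_mul_tmulRight]

theorem CSUq.isSystemMorphism : IsSystemMorphism (A := fun n => CSUq q (n + 2))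
    (fun n => CSUq.restrict q (n + 2)) (fun n => CSUq.comul q (n + 2)) :=
  fun _ a => CSUq.map_restrict_comul a

end SUqQuantumGroup

end

end SigmaCStar

theorem mainTheorem7_general :
    (∀ (A : Type*) [CStarAlgebra A] (Δ : A →⋆ₐ[ℂ] MinTensor A A),
      IsCompactQuantumGroup A Δ → IsSigmaCStarQuantumGroup A Δ) ∧
    (∀ (A : ℕ → Type*) [∀ n, CStarAlgebra (A n)] (θ : ∀ n, A (n + 1) →⋆ₐ[ℂ] A n)
      (Δ : ∀ n, A n →⋆ₐ[ℂ] MinTensor (A n) (A n)),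
      (∀ n, Function.Surjective (θ n)) →
      (∀ n, IsCompactQuantumGroup (A n) (Δ n)) →
      IsSystemMorphism θ Δ →
      TensorIsInverseLimit θ ∧
      ∃ Δlim : inverseLimit θ →⋆ₐ[ℂ] MinTensor (inverseLimit θ) (inverseLimit θ),
        IsLimitHom θ Δ Δlim ∧ (∀ Δ', IsLimitHom θ Δ Δ' → Δ' = Δlim) ∧
        IsSigmaCStarQuantumGroup (inverseLimit θ) Δlim) ∧
    (∀ q : ℝ, q ≠ 0 →
      (∀ n : ℕ, SUqRelations q (CSUq.gen q n) ∧
        ∀ (B : Type) [CStarAlgebra B] (v : Fin n → Fin n → B), SUqRelations q v →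
          ∃! φ : CSUq q n →⋆ₐ[ℂ] B, ∀ i j, φ (CSUq.gen q n i j) = v i j) ∧
      ∃ (Δ : ∀ n, CSUq q (n + 2) →⋆ₐ[ℂ] MinTensor (CSUq q (n + 2)) (CSUq q (n + 2)))
        (θ : ∀ n, CSUq q (n + 1 + 2) →⋆ₐ[ℂ] CSUq q (n + 2)),
        (∀ n i j, Δ n (CSUq.gen q (n + 2) i j) =
          ∑ k, tmul (CSUq.gen q (n + 2) i k) (CSUq.gen q (n + 2) k j)) ∧
        (∀ n i j, θ n (CSUq.gen q (n + 1 + 2) i j) =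
          if h : i.val < n + 2 ∧ j.val < n + 2 then
            CSUq.gen q (n + 2) ⟨i.val, h.1⟩ ⟨j.val, h.2⟩
          else if i = j then 1 else 0) ∧
        (∀ n, IsCompactQuantumGroup (CSUq q (n + 2)) (Δ n)) ∧
        (∀ n, Function.Surjective (θ n)) ∧
        IsSystemMorphism (A := fun n => CSUq q (n + 2)) θ Δ ∧
        ∃ Δlim : inverseLimit (A := fun n => CSUq q (n + 2)) θ →⋆ₐ[ℂ]
            MinTensor (inverseLimit (A := fun n => CSUq q (n + 2)) θ)
              (inverseLimit (A := fun n => CSUq q (n + 2)) θ),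
          IsLimitHom (A := fun n => CSUq q (n + 2)) θ Δ Δlim ∧
          IsSigmaCStarQuantumGroup (inverseLimit (A := fun n => CSUq q (n + 2)) θ) Δlim) := by
  refine ⟨fun A _ Δ h => h.isSigmaCStarQuantumGroup,
    fun A _ θ Δ hθ hΔ hs => inverseLimit_quantumGroup hθ hΔ hs, fun q hq =>
    ⟨fun n => ⟨CSUq.relations q n, fun B _ v hv => CSUq.existsUnique_hom hv⟩,
      fun n => CSUq.comul q (n + 2), fun n => CSUq.restrict q (n + 2),
      fun n i j => CSUq.comul_gen i j, fun n i j => CSUq.restrict_gen (n := n + 2) i j,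
      fun n => CSUq.isCompactQuantumGroup hq, fun n => CSUq.restrict_surjective,
      CSUq.isSystemMorphism, ?_⟩⟩
  have hlimit := inverseLimit_quantumGroup (A := fun n => CSUq q (n + 2))
    (θ := fun n => CSUq.restrict q (n + 2)) (fun n => CSUq.restrict_surjective)
    (fun n => CSUq.isCompactQuantumGroup hq) CSUq.isSystemMorphism
  exact hlimit.2.imp fun Δlim h => ⟨h.1, h.2.2⟩

theorem mainTheorem7 :
    -- a C⋆-compact quantum group is a σ-C⋆-quantum group
    (∀ (A : Type*) [CStarAlgebra A] (Δ : A →⋆ₐ[ℂ] MinTensor A A),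
      IsCompactQuantumGroup A Δ → IsSigmaCStarQuantumGroup A Δ) ∧
    -- inverse limits of C⋆-compact quantum groups
    (∀ (A : ℕ → Type*) [∀ n, CStarAlgebra (A n)] (θ : ∀ n, A (n + 1) →⋆ₐ[ℂ] A n)
      (Δ : ∀ n, A n →⋆ₐ[ℂ] MinTensor (A n) (A n)),
      (∀ n, Function.Surjective (θ n)) →
      (∀ n, IsCompactQuantumGroup (A n) (Δ n)) →
      IsSystemMorphism θ Δ →
      TensorIsInverseLimit θ ∧
      ∃ Δlim : inverseLimit θ →⋆ₐ[ℂ] MinTensor (inverseLimit θ) (inverseLimit θ),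
        IsLimitHom θ Δ Δlim ∧ (∀ Δ', IsLimitHom θ Δ Δ' → Δ' = Δlim) ∧
        IsSigmaCStarQuantumGroup (inverseLimit θ) Δlim) ∧
    -- the σ-C⋆-quantum group `C(SU_q(∞))`
    (∀ q : ℝ, 0 < q → q < 1 →
      (∀ n : ℕ, SUqRelations q (CSUq.gen q n) ∧
        ∀ (B : Type) [CStarAlgebra B] (v : Fin n → Fin n → B), SUqRelations q v →
          ∃! φ : CSUq q n →⋆ₐ[ℂ] B, ∀ i j, φ (CSUq.gen q n i j) = v i j) ∧
      ∃ (Δ : ∀ n, CSUq q (n + 2) →⋆ₐ[ℂ] MinTensor (CSUq q (n + 2)) (CSUq q (n + 2)))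
        (θ : ∀ n, CSUq q (n + 1 + 2) →⋆ₐ[ℂ] CSUq q (n + 2)),
        (∀ n i j, Δ n (CSUq.gen q (n + 2) i j) =
          ∑ k, tmul (CSUq.gen q (n + 2) i k) (CSUq.gen q (n + 2) k j)) ∧
        (∀ n i j, θ n (CSUq.gen q (n + 1 + 2) i j) =
          if h : i.val < n + 2 ∧ j.val < n + 2 then
            CSUq.gen q (n + 2) ⟨i.val, h.1⟩ ⟨j.val, h.2⟩
          else if i = j then 1 else 0) ∧
        (∀ n, IsCompactQuantumGroup (CSUq q (n + 2)) (Δ n)) ∧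
        (∀ n, Function.Surjective (θ n)) ∧
        IsSystemMorphism (A := fun n => CSUq q (n + 2)) θ Δ ∧
        ∃ Δlim : inverseLimit (A := fun n => CSUq q (n + 2)) θ →⋆ₐ[ℂ]
            MinTensor (inverseLimit (A := fun n => CSUq q (n + 2)) θ)
              (inverseLimit (A := fun n => CSUq q (n + 2)) θ),
          IsLimitHom (A := fun n => CSUq q (n + 2)) θ Δ Δlim ∧
          IsSigmaCStarQuantumGroup (inverseLimit (A := fun n => CSUq q (n + 2)) θ) Δlim) :=
  mainTheorem7_general.imp_right (And.imp_right fun h q hq _ => h q hq.ne')
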